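/- Let $P=(p_{xy})$ be an ergodic Markov chain on a finite vertex set $V$ with transitions along the edges of a graph $G(V,E)$ (loops allowed), reversible with respect to its stationary distribution $\pi$, and let $g\in V$ be the single marked vertex. Let $P'$ be the chain in which the transitions out of $g$ are replaced by a loop, and for $0\le s\le 1$ let $P(s)=(1-s)P+sP'$. For a fixed $\bar 0\in V$ let $W(s)=V(s)^\dagger\, \mathrm{Sw}\, V(s)\, R_{\bar 0}$ on $\mathbb C^V\otimes\mathbb C^V$, where $V(s)$ is any unitary with $V(s)|x\rangle|\bar 0\rangle=|x\rangle\sum_y\sqrt{P(s)_{xy}}\,|y\rangle$, $\mathrm{Sw}$ exchanges $|x\rangle|y\rangle$ and $|y\rangle|x\rangle$ for $(x,y)\in E$ and fixes the other basis vectors, and $R_{\bar 0}=I\otimes(2|\bar 0\rangle\langle\bar 0|-I)$. For $x\in V$ let $\mathrm{HT}(P,\{x\})=\sum_k |\langle v_k|\bar\pi_x\rangle|^2/(1-\lambda_k)$, where $(\lambda_k,v_k)$ runs through the eigenpairs with $\lambda_k\ne1$ of an orthonormal eigenbasis of the discriminant matrix $(\sqrt{Q_{yz}Q_{zy}})_{y,z}$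 of the chain $Q$ obtained from $P$ by making $x$ absorbing, and $|\bar\pi_x\rangle=(1-\pi_x)^{-1/2}\sum_{y\ne x}\sqrt{\pi_y}\,|y\rangle$; let $\mathrm{HT}=\max_x\mathrm{HT}(P,\{x\})$. Let $r\ge1$, $\varepsilon>0$, $\theta_i=\frac{i\pi}{2(r+1)}$ and $s_i=\frac{1-\pi_g/\sin^2\theta_i}{1-\pi_g}$ for $1\le i\le r$ (so that the stationary distribution of $P(s_i)$ gives $g$ the probability $\sin^2\theta_i$), and assume $\pi_g\le\sin^2\frac{\pi}{2(r+1)}$ (equivalently, $0\le s_i\le1$ for all $i$). Let $\Gamma=\frac{r\pi\sqrt{\mathrm{HT}}}{\sqrt2\,\varepsilon}$ and $\tau=\lceil\log_2\Gamma\rceil$. Consider the following algorithm. Prepare $|\pi\rangle|\bar 0\rangle|0^\tau\rangle$ with $|\pi\rangle=\sum_x\sqrt{\pi_x}|x\rangle$; measure whether the first register is $|g\rangle$ and if so output it and stop; otherwise apply, for $i=1,\dots,r$ in sequence, phase estimation of $W(s_i)$ with an ancilla register of $\tau$ qubits freshly initialised to $|0^\tau\rangle$ (Hadamard gates, controlled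 $W(s_i)^{2^j}$ for $j=0,\dots,\tau-1$, inverse quantum Fourier transform); finally measure and output the first register. A setup costs $\mathcal S$, a check $\mathcal C$, and each use of a controlled $W(s_i)$ costs one update $\mathcal U$ plus one check $\mathcal C$; the cost is that of a run that does not stop early. Then the following hold. 1. If $\varepsilon\le\cos^{r+1}\frac{\pi}{2(r+1)}$, the algorithm outputs $g$ with probability at least $\bigl(\cos^{r+1}\frac{\pi}{2(r+1)}-\varepsilon\bigr)^2$; the same bound holds for the conditional probability given that the initial check does not find $g$. 2. If $r\ge 11$ and $\varepsilon\le\frac1{200}$, then this bound, and hence both probabilities, exceed $4/5$. 3. If $\varepsilon\le\frac12$, the cost is $\mathcal S+\Theta(\varepsilon^{-1}\sqrt{\mathrm{HT}})(\mathcal U+\mathcal C)$ and the number $\tau$ of ancilla qubits is $\Theta(\log\varepsilon^{-1}+\log\sqrt{\mathrm{HT}})$, where the constants in $\Theta$ depend only on $r$. -/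

import Mathlib

open scoped Matrix

universe u

noncomputable section

namespace QSearch

/-! ## Markov chains -/

section Chain

variable {V : Type u} [Fintype V] [DecidableEq V]

/-- An ergodic chain: a stochastic matrix that is irreducible and aperiodic (the lengths of the
closed walks of positive probability have greatest common divisor one). -/
structure IsErgodic (P : Matrix V V ℝ) : Prop where
  stochastic : P ∈ Matrix.rowStochastic ℝ V
  irreducible : P.IsIrreducible
  aperiodic : ∀ (x : V) (d : ℕ), (∀ k : ℕ, 0 < (P ^ k) x x → d ∣ k) → d = 1

/-- `p` is a stationary probability distribution of `P`. -/
structure IsStationary (P : Matrix V V ℝ) (p : V → ℝ) : Prop where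
  nonneg : ∀ x, 0 ≤ p x
  sum_eq_one : ∑ x, p x = 1
  stationary : p ᵥ* P = p

/-- Detailed balance. -/
def IsReversible (P : Matrix V V ℝ) (p : V → ℝ) : Prop :=
  ∀ x y, p x * P x y = p y * P y x

/-- The transitions of `P` run along edges of `G` (loops are always allowed). -/
def IsOnGraph (G : SimpleGraph V) (P : Matrix V V ℝ) : Prop :=
  ∀ x y, x ≠ y → P x y ≠ 0 → G.Adj x y

/-- The absorbing chain: the transitions out of `g` are replaced by a loop. -/
def absorbing (P : Matrix V V ℝ) (g : V) : Matrix V V ℝ :=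
  Matrix.of fun x y => if x = g then (if y = g then 1 else 0) else P x y

/-- The interpolated chain `(1 - s) P + s P'`. -/
def interpolated (P : Matrix V V ℝ) (g : V) (s : ℝ) : Matrix V V ℝ :=
  (1 - s) • P + s • absorbing P g

/-- The discriminant matrix, the entrywise square root of `P ∘ Pᵀ`. -/
def discriminant {X : Type u} (P : Matrix X X ℝ) : Matrix X X ℝ :=
  Matrix.of fun x y => √(P x y * P y x)

theorem discriminant_isHermitian {X : Type u} (P : Matrix X X ℝ) : (discriminant P).IsHermitian := by
  ext x y
  simp [discriminant, mul_comm]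

/-- The amplitudes of the normalised restriction of `|π⟩` to the unmarked vertices. -/
def unmarkedAmp (p : V → ℝ) (g : V) (x : V) : ℝ :=
  if x = g then 0 else √(p x) / √(1 - p g)

/-- The hitting time of `g` through the spectrum of the discriminant of the absorbing chain;
the eigenvalue one, which belongs to the eigenvector `|g⟩`, is left out. -/
def hittingTimeTo (P : Matrix V V ℝ) (p : V → ℝ) (g : V) : ℝ :=
  ∑ k : V, if (discriminant_isHermitian (absorbing P g)).eigenvalues k = 1 then 0 else
    (∑ x, (discriminant_isHermitian (absorbing P g)).eigenvectorBasis k x * unmarkedAmp p g x) ^ 2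
      / (1 - (discriminant_isHermitian (absorbing P g)).eigenvalues k)

/-- The maximum hitting time over all vertices. -/
def hittingTime (P : Matrix V V ℝ) (p : V → ℝ) : ℝ :=
  ⨆ x : V, hittingTimeTo P p x

end Chain

/-! ## Quantum walk operators on `ℂ^V ⊗ ℂ^V` -/

section Walk

variable {V : Type u} [Fintype V] [DecidableEq V]

/-- `A` is an admissible `V(P)`: a unitary with `A |x⟩|o⟩ = |x⟩ ∑ y, √(P x y) |y⟩`,
arbitrary on the orthogonal complement of the vectors `|x⟩|o⟩`. -/
def IsChainUnitary (P : Matrix V V ℝ) (o : V) (A : Matrix (V × V) (V × V) ℂ) : Prop :=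
  A ∈ Matrix.unitaryGroup (V × V) ℂ ∧
    ∀ x x' y, A (x', y) (x, o) = if x' = x then ((√(P x y) : ℝ) : ℂ) else 0

/-- `|x⟩|y⟩ ↦ |y⟩|x⟩` on edges, and the identity on the other basis vectors. -/
def swapOp (G : SimpleGraph V) [DecidableRel G.Adj] : Matrix (V × V) (V × V) ℂ :=
  Matrix.of fun a b =>
    if G.Adj b.1 b.2 then (if a = (b.2, b.1) then 1 else 0) else (if a = b then 1 else 0)

/-- `I ⊗ (2 |o⟩⟨o| - I)`. -/
def reflOp (o : V) : Matrix (V × V) (V × V) ℂ :=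
  Matrix.diagonal fun a => if a.2 = o then 1 else -1

/-- The walk operator `V(P)† S V(P) R`, for `A = V(P)`. -/
def walkOp (G : SimpleGraph V) [DecidableRel G.Adj] (o : V) (A : Matrix (V × V) (V × V) ℂ) :
    Matrix (V × V) (V × V) ℂ :=
  Aᴴ * swapOp G * A * reflOp o

end Walk

/-! ## Programs

Three registers: two vertex registers and `t` ancilla qubits. -/

/-- The basis of the state space. -/
abbrev Idx (V : Type u) (t : ℕ) : Type u := (V × V) × (Fin t → Bool)

/-- Elementary instructions of a search program with `r` walk operators and `t` ancilla qubits. -/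
inductive Instr (r t : ℕ) : Type
  /-- prepare the stationary state, with the other registers in their initial states -/
  | setup
  /-- measure whether the first register holds the marked vertex; if so, output it and stop -/
  | check
  /-- discard the ancilla register and initialise it afresh to the all-zero state -/
  | reset
  /-- Hadamard gate on an ancilla qubit -/
  | hadamard (j : Fin t)
  /-- the `i`-th walk operator on the vertex registers, controlled by the `j`-th ancilla qubit -/
  | ctrlWalk (i : Fin r) (j : Fin t)
  /-- inverse quantum Fourier transform on the ancilla register -/
  | invQFT

/-- Cost of an instruction: `S` for a setup, `C` for a check, and one update and one check for each
use of a (controlled) walk operator of an interpolated chain. -/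
def Instr.cost {r t : ℕ} (S U C : ℝ) : Instr r t → ℝ
  | .setup => S
  | .check => C
  | .ctrlWalk _ _ => U + C
  | .reset => 0
  | .hadamard _ => 0
  | .invQFT => 0

/-- Cost of a program that runs to its end. -/
def programCost {r t : ℕ} (S U C : ℝ) (prog : List (Instr r t)) : ℝ :=
  (prog.map (Instr.cost S U C)).sum

/-- Phase estimation of the `i`-th walk operator `W` with `t` ancilla qubits: starting from a fresh
ancilla register, Hadamard gates, then controlled `W ^ (2 ^ j)` for each `j < t` (as `2 ^ j`
controlled uses of `W`), then the inverse Fourier transform. -/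
def phaseEstimation {r : ℕ} (t : ℕ) (i : Fin r) : List (Instr r t) :=
  [Instr.reset] ++ (List.finRange t).map Instr.hadamard ++
    (List.finRange t).flatMap (fun j : Fin t => List.replicate (2 ^ (j : ℕ)) (Instr.ctrlWalk i j)) ++
    [Instr.invQFT]

/-- Phase estimations of all the walk operators, one after the other. -/
def searchLoop (r t : ℕ) : List (Instr r t) :=
  (List.finRange r).flatMap (phaseEstimation t)

/-- The search program (the final measurement of the first register is part of its evaluation). -/
def searchProgram (r t : ℕ) : List (Instr r t) :=
  [Instr.setup, Instr.check] ++ searchLoop r t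

section Semantics

variable {V : Type u} [Fintype V] [DecidableEq V]

/-- State of a run: the probability of having stopped with the marked vertex as output, and the
unnormalised density matrix of the runs that go on. -/
structure RunState (V : Type u) (t : ℕ) where
  stopped : ℝ
  density : Matrix (Idx V t) (Idx V t) ℂ

/-- The density matrix of the pure state `(∑ x, v x |x⟩) |o⟩ |0⋯0⟩`. -/
def pureDensity (t : ℕ) (o : V) (v : V → ℝ) : Matrix (Idx V t) (Idx V t) ℂ :=
  let w : Idx V t → ℂ := fun a =>
    if a.1.2 = o ∧ a.2 = (fun _ => false) then ((v a.1.1 : ℝ) : ℂ) else 0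
  Matrix.vecMulVec w (star w)

/-- The integer whose binary digits are the ancilla bits. -/
def bitVal {t : ℕ} (m : Fin t → Bool) : ℕ :=
  ∑ j, if m j then 2 ^ (j : ℕ) else 0

/-- Hadamard gate on the `j`-th ancilla qubit. -/
def hadamardOp {t : ℕ} (j : Fin t) : Matrix (Idx V t) (Idx V t) ℂ :=
  Matrix.of fun a b =>
    if a.1 = b.1 ∧ ∀ k, k ≠ j → a.2 k = b.2 k then
      ((1 / √2 : ℝ) : ℂ) * (if a.2 j = true ∧ b.2 j = true then -1 else 1)
    else 0

/-- `W` on the vertex registers, controlled by the `j`-th ancilla qubit. -/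
def ctrlOp {t : ℕ} (W : Matrix (V × V) (V × V) ℂ) (j : Fin t) :
    Matrix (Idx V t) (Idx V t) ℂ :=
  Matrix.of fun a b =>
    if a.2 = b.2 then
      (if b.2 j = true then W a.1 b.1 else (1 : Matrix (V × V) (V × V) ℂ) a.1 b.1)
    else 0

/-- Inverse quantum Fourier transform on the ancilla register. -/
def invQFTOp (t : ℕ) : Matrix (Idx V t) (Idx V t) ℂ :=
  Matrix.of fun a b =>
    if a.1 = b.1 then
      ((1 / √(2 ^ t) : ℝ) : ℂ) *
        Complex.exp (-(2 * Real.pi * Complex.I * (bitVal b.2 : ℂ) * (bitVal a.2 : ℂ) / 2 ^ t))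
    else 0

/-- The probability (weight) of finding the first register at `g`. -/
def markedWeight {t : ℕ} (g : V) (ρ : Matrix (Idx V t) (Idx V t) ℂ) : ℝ :=
  ∑ a : Idx V t, if a.1.1 = g then (ρ a a).re else 0

/-- Effect of one instruction, for walk operators `W i`, marked vertex `g`, initial state `o` of
the second register, and stationary distribution `p`. -/
def Instr.run {r t : ℕ} (W : Fin r → Matrix (V × V) (V × V) ℂ) (p : V → ℝ) (g o : V) :
    Instr r t → RunState V t → RunState V t
  | .setup, σ => ⟨σ.stopped, σ.density.trace • pureDensity t o (fun x => √(p x))⟩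
  | .check, σ => ⟨σ.stopped + markedWeight g σ.density,
      Matrix.of fun a b => if a.1.1 = g ∨ b.1.1 = g then 0 else σ.density a b⟩
  | .reset, σ => ⟨σ.stopped,
      Matrix.of fun a b => if a.2 = (fun _ => false) ∧ b.2 = (fun _ => false) then
        ∑ m, σ.density (a.1, m) (b.1, m) else 0⟩
  | .hadamard j, σ => ⟨σ.stopped, hadamardOp j * σ.density * (hadamardOp j)ᴴ⟩
  | .ctrlWalk i j, σ => ⟨σ.stopped, ctrlOp (W i) j * σ.density * (ctrlOp (W i) j)ᴴ⟩
  | .invQFT, σ => ⟨σ.stopped, invQFTOp t * σ.density * (invQFTOp t)ᴴ⟩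

/-- Run a program, from its first instruction to its last, from a given density matrix, then measure
the first register: the probability that the output is `g`. -/
def successProb {r t : ℕ} (W : Fin r → Matrix (V × V) (V × V) ℂ) (p : V → ℝ) (g o : V)
    (prog : List (Instr r t)) (ρ : Matrix (Idx V t) (Idx V t) ℂ) : ℝ :=
  let σ := prog.foldl (fun σ ins => ins.run W p g o σ) ⟨0, ρ⟩
  σ.stopped + markedWeight g σ.density

end Semantics

/-! ## Parameters of the algorithm -/

section Parameters

variable {V : Type u} [Fintype V] [DecidableEq V]

/-- The angles `θ_i = i π / (2 (r + 1))` for `i = 1, …, r`; the index `i : Fin r` stands for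
`i + 1`. -/
def angle (r : ℕ) (i : Fin r) : ℝ := ((i : ℕ) + 1) * Real.pi / (2 * (r + 1))

/-- The interpolation parameters. The stationary distribution of the interpolated chain with
parameter `s` gives `g` the probability `q / (1 - s (1 - q))`, where `q` is the stationary
probability of `g` in the original chain, and this equals `sin² θ_i` for `s` as below. -/
def interpParam (r : ℕ) (q : ℝ) (i : Fin r) : ℝ :=
  (1 - q / Real.sin (angle r i) ^ 2) / (1 - q)

/-- The precision `Γ = r π √HT / (√2 ε)`. -/
def precision (r : ℕ) (P : Matrix V V ℝ) (p : V → ℝ) (ε : ℝ) : ℝ :=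
  r * Real.pi * √(hittingTime P p) / (√2 * ε)

/-- The number `⌈log₂ Γ⌉` of ancilla qubits. -/
def numAncilla (r : ℕ) (P : Matrix V V ℝ) (p : V → ℝ) (ε : ℝ) : ℕ :=
  ⌈Real.logb 2 (precision r P p ε)⌉₊

/-- `cos^(r+1) (π / (2 (r + 1)))`. -/
def cosBound (r : ℕ) : ℝ := Real.cos (Real.pi / (2 * (r + 1))) ^ (r + 1)

end Parameters

end QSearch

end

/-! Let `|U⟩` be the normalised unmarked part of the stationary state, and let `ψ_k` be the unit
vector in the plane of `|U⟩` and `|g⟩` at angle `kδ` from `|U⟩`, where `δ = π / (2 (r + 1))`. The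
entrywise square of `ψ_i` is reversing for `P(s_i)`. Hence the discriminant fixes `ψ_i`, and
`W(s_i)` fixes `ψ_i ⊗ |o⟩` (`walkOp_embed_of_fixed`).

The zero outcome of phase estimation with `N = 2 ^ τ` acts as the average of `W ^ k` over `k < N`
(`phaseEstimation_run`). This average fixes `ψ_i`. The vector `u` orthogonal to `ψ_i` in the plane
is a coboundary `χ - W χ`, so its average telescopes to norm at most `2 ‖χ‖ / N`; no analysis of the
spectrum of `W` is needed. To find `χ`, take the solution `f` of `f - D' f = U` for the absorbing
discriminant `D'`. A multiple of it solves the Poisson equation with right side `u / 2` for the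
discriminant of `P(s_i)` (`interpolated_resolvent`), and `exists_walkOp_coboundary` lifts this to
the walk with `‖χ‖² = sin² θ_i · HT(P, {g}) / 2`. With `N ≥ Γ` the error of a step is at most `ε /
r`.

So each zero outcome sends `ψ_{i-1}` to `cos δ · ψ_i` up to `ε / r`. After `r` steps the branch is
within `ε` of `cos^r δ · ψ_r`, whose amplitude at `g` is `cos^(r+1) δ`, because `rδ = π/2 - δ`. The
other outcomes only add positive semidefinite terms to the density matrix (`Dominates`), so this one
branch bounds the success probability from below. The initial check can only help, since the bound
is at most one.

The cost and ancilla bounds follow from `Γ ≤ 2 ^ τ ≤ 2Γ` and `HT ≥ 1/2`. -/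

noncomputable section
namespace QSearch

/-! ### Spectrum and resolvent of the absorbing discriminant. -/

section ChainFacts

variable {V : Type u}

theorem discriminant_apply (P : Matrix V V ℝ) (x y : V) :
    discriminant P x y = √(P x y * P y x) := rfl

theorem discriminant_symm (P : Matrix V V ℝ) (x y : V) :
    discriminant P x y = discriminant P y x := by
  rw [discriminant_apply, discriminant_apply, mul_comm]

/-- A nonempty set that is closed under predecessors of an irreducible chain is everything. -/
theorem forall_of_irreducible {P : Matrix V V ℝ} (hP : P.IsIrreducible) {Z : V → Prop} {g : V}
    (hg : Z g) (hZ : ∀ x y, 0 < P x y → Z y → Z x) (x : V) : Z x := by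
  let : Quiver V := P.toQuiver
  obtain ⟨q, -⟩ := hP.connected x g
  have key : ∀ (y : V) (q : Quiver.Path x y), Z y → Z x := by
    intro y q
    induction q with
    | nil => exact id
    | cons _ e ih => exact fun h => ih (hZ _ _ e.down h)
  exact key g q hg

section

variable [DecidableEq V]

theorem absorbing_nonneg {P : Matrix V V ℝ} (h0 : ∀ x y, 0 ≤ P x y) (g x y : V) :
    0 ≤ absorbing P g x y := by
  simp only [absorbing, Matrix.of_apply]
  split_ifs
  · exact zero_le_one
  · exact le_rfl
  · exact h0 x y

theorem absorbing_self (P : Matrix V V ℝ) (g y : V) :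
    absorbing P g g y = if y = g then 1 else 0 := by simp [absorbing]

theorem absorbing_of_ne (P : Matrix V V ℝ) {g x : V} (h : x ≠ g) (y : V) :
    absorbing P g x y = P x y := by simp [absorbing, h]

theorem discriminant_absorbing_self (P : Matrix V V ℝ) (g y : V) :
    discriminant (absorbing P g) g y = if y = g then 1 else 0 := by
  by_cases h : y = g
  · subst h; simp [discriminant_apply, absorbing_self]
  · simp [discriminant_apply, absorbing_self, h]

theorem discriminant_absorbing_of_ne (P : Matrix V V ℝ) {g x y : V} (hx : x ≠ g) (hy : y ≠ g) :
    discriminant (absorbing P g) x y = discriminant P x y := by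
  simp [discriminant_apply, absorbing_of_ne, hx, hy]

theorem unmarkedAmp_self (p : V → ℝ) (g : V) : unmarkedAmp p g g = 0 := by simp [unmarkedAmp]

end

variable [Fintype V]

theorem sum_mul_discriminant_mulVec (P : Matrix V V ℝ) (v w : V → ℝ) :
    ∑ x, v x * (discriminant P *ᵥ w) x = ∑ x, (discriminant P *ᵥ v) x * w x := by
  simp only [Matrix.mulVec, dotProduct, Finset.mul_sum, Finset.sum_mul]
  rw [Finset.sum_comm]
  refine Finset.sum_congr rfl fun x _ => Finset.sum_congr rfl fun y _ => ?_
  rw [discriminant_symm]; ring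

/-- The Dirichlet form of the discriminant. -/
theorem sum_sq_discriminant {Q : Matrix V V ℝ} (h0 : ∀ x y, 0 ≤ Q x y) (h1 : ∀ x, ∑ y, Q x y = 1)
    (v : V → ℝ) (c : ℝ) (hc : c ^ 2 = 1) :
    ∑ x, ∑ y, (√(Q x y) * v x - c * (√(Q y x) * v y)) ^ 2 =
      2 * ∑ x, v x ^ 2 - 2 * c * ∑ x, v x * (discriminant Q *ᵥ v) x := by
  have e : ∀ x y, (√(Q x y) * v x - c * (√(Q y x) * v y)) ^ 2 =
      Q x y * v x ^ 2 + Q y x * v y ^ 2 - 2 * c * (v x * (discriminant Q x y * v y)) := by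
    intro x y
    rw [discriminant_apply, Real.sqrt_mul (h0 x y)]
    have h2 := Real.sq_sqrt (h0 x y)
    have h3 := Real.sq_sqrt (h0 y x)
    linear_combination v x ^ 2 * h2 + c ^ 2 * v y ^ 2 * h3 + Q y x * v y ^ 2 * hc
  simp only [e, Finset.sum_sub_distrib, Finset.sum_add_distrib]
  rw [Finset.sum_comm (f := fun x y => Q y x * v y ^ 2)]
  simp only [← Finset.sum_mul, h1, Matrix.mulVec, dotProduct, Finset.mul_sum]
  simp only [one_mul, two_mul, Finset.sum_add_distrib]

/-- The Dirichlet form is nonnegative for both signs `c = ±1`; one sign gives each bound. -/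
theorem abs_le_one_of_discriminant_mulVec {Q : Matrix V V ℝ} (h0 : ∀ x y, 0 ≤ Q x y)
    (h1 : ∀ x, ∑ y, Q x y = 1) {v : V → ℝ} (hv : 0 < ∑ x, v x ^ 2) {l : ℝ}
    (hl : discriminant Q *ᵥ v = l • v) : -1 ≤ l ∧ l ≤ 1 := by
  have key : ∀ c : ℝ, c ^ 2 = 1 → 0 ≤ 2 * (1 - c * l) * ∑ x, v x ^ 2 := by
    intro c hc
    have h := sum_sq_discriminant h0 h1 v c hc
    have h' : ∑ x, v x * (discriminant Q *ᵥ v) x = l * ∑ x, v x ^ 2 := by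
      rw [hl, Finset.mul_sum]
      exact Finset.sum_congr rfl fun x _ => by simp; ring
    rw [h'] at h
    have : 0 ≤ ∑ x, ∑ y, (√(Q x y) * v x - c * (√(Q y x) * v y)) ^ 2 := by positivity
    linarith
  have a := key 1 (by norm_num)
  have b := key (-1) (by norm_num)
  constructor
  · have := nonneg_of_mul_nonneg_left b hv; linarith
  · have := nonneg_of_mul_nonneg_left a hv; linarith

variable [DecidableEq V]

theorem sum_absorbing {P : Matrix V V ℝ} (h1 : ∀ x, ∑ y, P x y = 1) (g x : V) :
    ∑ y, absorbing P g x y = 1 := by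
  by_cases h : x = g <;> simp [absorbing, h, h1]

theorem discriminant_absorbing_mulVec_self (P : Matrix V V ℝ) (g : V) (v : V → ℝ) :
    (discriminant (absorbing P g) *ᵥ v) g = v g := by
  simp [Matrix.mulVec, dotProduct, discriminant_absorbing_self]

/-- The eigenvalue one of the discriminant of an absorbing chain belongs to the absorbing vertex. -/
theorem eq_zero_of_discriminant_absorbing_mulVec {P : Matrix V V ℝ} (hP : P.IsIrreducible)
    (h1 : ∀ x, ∑ y, P x y = 1) {g : V} {v : V → ℝ}
    (hv : discriminant (absorbing P g) *ᵥ v = v) {x : V} (hx : x ≠ g) : v x = 0 := by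
  have h := sum_sq_discriminant (absorbing_nonneg hP.nonneg g) (sum_absorbing h1 g) v 1 (by norm_num)
  rw [hv] at h
  have h' : ∑ x, ∑ y, (√(absorbing P g x y) * v x - 1 * (√(absorbing P g y x) * v y)) ^ 2 = 0 := by
    rw [h]; simp only [pow_two]; ring
  have e : ∀ x y, √(absorbing P g x y) * v x = √(absorbing P g y x) * v y := by
    intro x y
    have h2 := (Finset.sum_eq_zero_iff_of_nonneg (fun x _ => by positivity)).1 h' x
      (Finset.mem_univ x)
    have h3 := (Finset.sum_eq_zero_iff_of_nonneg (fun x _ => by positivity)).1 h2 y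
      (Finset.mem_univ y)
    have := pow_eq_zero_iff (two_ne_zero) |>.1 h3
    linarith
  -- Nothing leaves `g`, so the vanishing Dirichlet form kills `v` at the predecessors of `g`; zeros
  -- then propagate backwards along transitions.
  have key : ∀ x, x = g ∨ v x = 0 := by
    refine forall_of_irreducible hP (Z := fun x => x = g ∨ v x = 0) (g := g) (Or.inl rfl) ?_
    intro x y hxy hy
    by_cases hx : x = g
    · exact Or.inl hx
    refine Or.inr ?_
    have h2 := e x y
    rw [absorbing_of_ne P hx] at h2
    have h3 : √(absorbing P g y x) * v y = 0 := by
      rcases hy with rfl | hy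
      · rw [absorbing_self, if_neg hx]; simp
      · rw [hy, mul_zero]
    rw [h3] at h2
    exact (mul_eq_zero.1 h2).resolve_left (Real.sqrt_pos.2 hxy).ne'
  exact (key x).resolve_left hx

theorem sum_sq_unmarkedAmp {p : V → ℝ} (h0 : ∀ x, 0 ≤ p x) (h1 : ∑ x, p x = 1) {g : V}
    (hg : p g < 1) : ∑ x, unmarkedAmp p g x ^ 2 = 1 := by
  have hq : 0 < 1 - p g := by linarith
  have e : ∀ x, unmarkedAmp p g x ^ 2 = (p x - if x = g then p x else 0) / (1 - p g) := by
    intro x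
    by_cases h : x = g
    · simp [unmarkedAmp, h]
    · simp only [unmarkedAmp, h, if_false, div_pow, Real.sq_sqrt (h0 x), Real.sq_sqrt hq.le, sub_zero]
  simp only [e, ← Finset.sum_div, Finset.sum_sub_distrib, h1, Finset.sum_ite_eq', Finset.mem_univ,
    if_true]
  exact div_self hq.ne'

theorem hittingTimeTo_le_hittingTime (P : Matrix V V ℝ) (p : V → ℝ) (g : V) :
    hittingTimeTo P p g ≤ hittingTime P p :=
  le_ciSup (f := fun x => hittingTimeTo P p x) (Set.finite_range _).bddAbove g

/-- The hitting time is the quadratic form of the resolvent of the absorbing discriminant. -/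
theorem exists_resolvent {P : Matrix V V ℝ} (hP : P.IsIrreducible)
    (h1 : ∀ x, ∑ y, P x y = 1) {p : V → ℝ} (hp0 : ∀ x, 0 ≤ p x) (hp1 : ∑ x, p x = 1) {g : V}
    (hg : p g < 1) :
    ∃ f : V → ℝ, f g = 0 ∧ (∀ x, f x - (discriminant (absorbing P g) *ᵥ f) x = unmarkedAmp p g x) ∧
      ∑ x, unmarkedAmp p g x * f x = hittingTimeTo P p g ∧ 1 / 2 ≤ hittingTimeTo P p g := by
  set D := discriminant (absorbing P g) with hD
  set hH := discriminant_isHermitian (absorbing P g)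
  set lam := hH.eigenvalues with hlam
  set b := hH.eigenvectorBasis with hb
  set U := unmarkedAmp p g with hU
  set c : V → ℝ := fun k => ∑ x, b k x * U x with hc
  have hDb : ∀ k x, (D *ᵥ (b k : V → ℝ)) x = lam k * b k x := fun k x => by
    have := congrFun (hH.mulVec_eigenvectorBasis k) x
    simpa using this
  have hnorm : ∀ k, ∑ x, b k x ^ 2 = 1 := fun k => by
    have := b.orthonormal.1 k
    rw [EuclideanSpace.norm_eq, Real.sqrt_eq_one] at this
    simpa using this
  have hbound : ∀ k, -1 ≤ lam k ∧ lam k ≤ 1 := fun k =>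
    abs_le_one_of_discriminant_mulVec (absorbing_nonneg hP.nonneg g) (sum_absorbing h1 g)
      (v := b k) (by rw [hnorm]; norm_num) (by ext x; simpa using hDb k x)
  -- An eigenvector for the eigenvalue one lives on `g`, where `U` vanishes; so leaving this
  -- eigenvalue out of the hitting time loses nothing.
  have hc0 : ∀ k, lam k = 1 → c k = 0 := by
    intro k hk
    refine Finset.sum_eq_zero fun x _ => ?_
    by_cases hx : x = g
    · rw [hx, hU, unmarkedAmp_self, mul_zero]
    · rw [eq_zero_of_discriminant_absorbing_mulVec hP h1 (v := b k)
        (by ext x; have := hDb k x; rw [hk, one_mul] at this; exact this) hx, zero_mul]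
  have hbg : ∀ k, lam k ≠ 1 → b k g = 0 := by
    intro k hk
    have h2 := hDb k g
    rw [hD, discriminant_absorbing_mulVec_self] at h2
    have : (1 - lam k) * b k g = 0 := by linarith
    exact (mul_eq_zero.1 this).resolve_left (sub_ne_zero.2 hk.symm)
  have hinner : ∀ k, inner ℝ (b k) (WithLp.toLp 2 U : EuclideanSpace ℝ V) = c k := by
    intro k
    rw [PiLp.inner_apply]
    exact Finset.sum_congr rfl fun x _ => by simp [mul_comm]
  have hexp : ∀ x, U x = ∑ k, c k * b k x := by
    intro x
    have := congrArg (fun v : EuclideanSpace ℝ V => v x)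
      (b.sum_repr' (WithLp.toLp 2 U : EuclideanSpace ℝ V))
    simp only [hinner] at this
    refine this.symm.trans ?_
    simp
  have hpars : ∑ k, c k ^ 2 = 1 := by
    have h2 : ∑ x, U x * U x = ∑ k, c k ^ 2 := by
      calc ∑ x, U x * U x = ∑ x, ∑ k, c k * (b k x * U x) := by
            refine Finset.sum_congr rfl fun x _ => ?_
            nth_rw 1 [hexp x]
            rw [Finset.sum_mul]
            exact Finset.sum_congr rfl fun k _ => by ring
        _ = ∑ k, c k ^ 2 := by
            rw [Finset.sum_comm]
            refine Finset.sum_congr rfl fun k _ => ?_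
            rw [← Finset.mul_sum, sq]
    rw [← h2, ← sum_sq_unmarkedAmp hp0 hp1 hg]
    exact Finset.sum_congr rfl fun x _ => (sq _).symm
  -- Coefficients of the pseudo-inverse of `1 - D` applied to `U`. The value zero at eigenvalue one
  -- makes the solution vanish at `g`.
  set d : V → ℝ := fun k => if lam k = 1 then 0 else c k / (1 - lam k) with hd
  have hHT : hittingTimeTo P p g = ∑ k, if lam k = 1 then 0 else c k ^ 2 / (1 - lam k) := rfl
  refine ⟨fun x => ∑ k, d k * b k x, ?_, ?_, ?_, ?_⟩
  · refine Finset.sum_eq_zero fun k _ => ?_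
    by_cases hk : lam k = 1
    · simp [hd, hk]
    · rw [hbg k hk, mul_zero]
  · intro x
    have h2 : (D *ᵥ fun x => ∑ k, d k * b k x) x = ∑ k, d k * (lam k * b k x) := by
      simp only [← hDb, Matrix.mulVec, dotProduct, Finset.mul_sum]
      rw [Finset.sum_comm]
      exact Finset.sum_congr rfl fun k _ => Finset.sum_congr rfl fun y _ => by ring
    rw [h2, ← Finset.sum_sub_distrib, hexp x]
    refine Finset.sum_congr rfl fun k _ => ?_
    by_cases hk : lam k = 1
    · simp [hd, hk, hc0 k hk]
    · have : 1 - lam k ≠ 0 := sub_ne_zero.2 (Ne.symm hk)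
      simp only [hd, hk, if_false]
      field_simp
  · rw [hHT]
    change ∑ x, U x * ∑ k, d k * b k x = _
    simp only [Finset.mul_sum]
    rw [Finset.sum_comm]
    refine Finset.sum_congr rfl fun k _ => ?_
    have : ∑ x, U x * (d k * b k x) = d k * c k := by
      rw [hc, Finset.mul_sum]
      exact Finset.sum_congr rfl fun x _ => by ring
    rw [this]
    by_cases hk : lam k = 1
    · simp [hd, hk]
    · simp only [hd, hk, if_false]; ring
  -- The weights `c k ^ 2` sum to one and `1 - lam k ≤ 2`.
  · have e : (1 / 2 : ℝ) = ∑ k, c k ^ 2 / 2 := by rw [← Finset.sum_div, hpars]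
    rw [hHT, e]
    refine Finset.sum_le_sum fun k _ => ?_
    by_cases hk : lam k = 1
    · simp [hk, hc0 k hk]
    · rw [if_neg hk]
      have h3 := hbound k
      have : lam k < 1 := lt_of_le_of_ne h3.2 hk
      exact div_le_div_of_nonneg_left (sq_nonneg _) (by linarith) (by linarith)

theorem hittingTime_ge {P : Matrix V V ℝ} (hP : P.IsIrreducible)
    (h1 : ∀ x, ∑ y, P x y = 1) {p : V → ℝ} (hp0 : ∀ x, 0 ≤ p x) (hp1 : ∑ x, p x = 1) {g : V}
    (hg : p g < 1) : 1 / 2 ≤ hittingTime P p := by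
  obtain ⟨f, -, -, -, h⟩ := exists_resolvent hP h1 hp0 hp1 hg
  exact h.trans (hittingTimeTo_le_hittingTime P p g)

end ChainFacts

/-! ### Fixed vector and Poisson equation of the interpolated discriminant. -/

section InterpolatedFacts

variable {V : Type u} [DecidableEq V]

theorem interpolated_apply (P : Matrix V V ℝ) (g : V) (s : ℝ) (x y : V) :
    interpolated P g s x y = (1 - s) * P x y + s * absorbing P g x y := by
  simp [interpolated]

theorem interpolated_of_ne (P : Matrix V V ℝ) {g x : V} (hx : x ≠ g) (s : ℝ) (y : V) :
    interpolated P g s x y = P x y := by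
  rw [interpolated_apply, absorbing_of_ne P hx]; ring

theorem interpolated_self_of_ne (P : Matrix V V ℝ) {g y : V} (hy : y ≠ g) (s : ℝ) :
    interpolated P g s g y = (1 - s) * P g y := by
  rw [interpolated_apply, absorbing_self, if_neg hy]; ring

theorem interpolated_nonneg {P : Matrix V V ℝ} (h0 : ∀ x y, 0 ≤ P x y) (g : V) {s : ℝ}
    (hs0 : 0 ≤ s) (hs1 : s ≤ 1) (x y : V) : 0 ≤ interpolated P g s x y := by
  rw [interpolated_apply]
  exact add_nonneg (mul_nonneg (by linarith) (h0 x y))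
    (mul_nonneg hs0 (absorbing_nonneg h0 g x y))

theorem interpolated_isOnGraph {G : SimpleGraph V} {P : Matrix V V ℝ} (hG : IsOnGraph G P) (g : V)
    (s : ℝ) : IsOnGraph G (interpolated P g s) := by
  intro x y hxy h
  refine hG x y hxy fun hP => h ?_
  by_cases hx : x = g
  · subst hx
    rw [interpolated_self_of_ne P hxy.symm, hP, mul_zero]
  · rw [interpolated_of_ne P hx, hP]

theorem discriminant_interpolated_of_ne (P : Matrix V V ℝ) {g x y : V} (hx : x ≠ g) (hy : y ≠ g)
    (s : ℝ) : discriminant (interpolated P g s) x y = discriminant (absorbing P g) x y := by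
  rw [discriminant_absorbing_of_ne P hx hy, discriminant_apply, discriminant_apply,
    interpolated_of_ne P hx, interpolated_of_ne P hy]

/-- The amplitudes of `α |U⟩ + β |g⟩`, with `|U⟩` the unmarked part of the stationary state. -/
def planeAmp (p : V → ℝ) (g : V) (α β : ℝ) (x : V) : ℝ :=
  α * unmarkedAmp p g x + if x = g then β else 0

theorem planeAmp_self (p : V → ℝ) (g : V) (α β : ℝ) : planeAmp p g α β g = β := by
  simp [planeAmp, unmarkedAmp_self]

theorem planeAmp_of_ne (p : V → ℝ) {g x : V} (hx : x ≠ g) (α β : ℝ) :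
    planeAmp p g α β x = α * unmarkedAmp p g x := by
  simp [planeAmp, hx]

variable [Fintype V]

theorem sum_interpolated {P : Matrix V V ℝ} (h1 : ∀ x, ∑ y, P x y = 1) (g : V) (s : ℝ) (x : V) :
    ∑ y, interpolated P g s x y = 1 := by
  simp only [interpolated_apply, Finset.sum_add_distrib, ← Finset.mul_sum, h1, sum_absorbing h1]
  ring

omit [DecidableEq V] in
/-- The square root of a reversing measure is fixed by the discriminant. -/
theorem discriminant_mulVec_of_reversing {Q : Matrix V V ℝ} (h0 : ∀ x y, 0 ≤ Q x y)
    (h1 : ∀ x, ∑ y, Q x y = 1) {ψ : V → ℝ} (hψ : ∀ x, 0 ≤ ψ x)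
    (hrev : ∀ x y, ψ x ^ 2 * Q x y = ψ y ^ 2 * Q y x) : discriminant Q *ᵥ ψ = ψ := by
  ext x
  have e : ∀ y, discriminant Q x y * ψ y = Q x y * ψ x := by
    intro y
    rw [discriminant_apply, ← Real.sqrt_sq (hψ y), ← Real.sqrt_mul (mul_nonneg (h0 x y) (h0 y x))]
    rw [show Q x y * Q y x * ψ y ^ 2 = (Q x y * ψ x) ^ 2 by
      linear_combination (-Q x y) * hrev x y]
    exact Real.sqrt_sq (mul_nonneg (h0 x y) (hψ x))
  simp only [Matrix.mulVec, dotProduct, e, ← Finset.sum_mul, h1, one_mul]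

/-- The squared amplitudes are proportional to `p` off `g`, so detailed balance there is inherited
from `P`. The hypothesis `hs` is what balances the flow between `g` and the other vertices. -/
theorem discriminant_interpolated_mulVec {P : Matrix V V ℝ} (h0 : ∀ x y, 0 ≤ P x y)
    (h1 : ∀ x, ∑ y, P x y = 1) {p : V → ℝ} (hp : ∀ x, 0 ≤ p x) (hrev : IsReversible P p) {g : V}
    (hg : p g < 1) {s α β : ℝ} (hs0 : 0 ≤ s) (hs1 : s ≤ 1) (hα : 0 ≤ α) (hβ : 0 ≤ β)
    (hs : (1 - s) * β ^ 2 * (1 - p g) = p g * α ^ 2) :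
    discriminant (interpolated P g s) *ᵥ planeAmp p g α β = planeAmp p g α β := by
  have hq : 0 < 1 - p g := by linarith
  have hU : ∀ x, x ≠ g → unmarkedAmp p g x ^ 2 = p x / (1 - p g) := fun x hx => by
    rw [unmarkedAmp, if_neg hx, div_pow, Real.sq_sqrt (hp x), Real.sq_sqrt hq.le]
  have hbeta : (1 - s) * β ^ 2 = p g * α ^ 2 / (1 - p g) := by rw [eq_div_iff hq.ne', hs]
  have hmix : ∀ y, y ≠ g → β ^ 2 * ((1 - s) * P g y) = α ^ 2 * (p y / (1 - p g)) * P y g := by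
    intro y _
    have := hrev g y
    calc β ^ 2 * ((1 - s) * P g y) = (1 - s) * β ^ 2 * P g y := by ring
      _ = α ^ 2 / (1 - p g) * (p g * P g y) := by rw [hbeta]; ring
      _ = _ := by rw [this]; ring
  refine discriminant_mulVec_of_reversing (interpolated_nonneg h0 g hs0 hs1)
    (sum_interpolated h1 g s) ?_ ?_
  · intro x
    refine add_nonneg (mul_nonneg hα ?_) ?_
    · rw [unmarkedAmp]; split_ifs <;> positivity
    · split_ifs <;> simp [hβ]
  · intro x y
    by_cases hx : x = g <;> by_cases hy : y = g
    · rw [hx, hy]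
    · rw [hx, planeAmp_self, planeAmp_of_ne p hy, interpolated_self_of_ne P hy,
        interpolated_of_ne P hy, mul_pow, hU y hy, hmix y hy]
    · rw [hy, planeAmp_self, planeAmp_of_ne p hx, interpolated_self_of_ne P hx,
        interpolated_of_ne P hx, mul_pow, hU x hx, hmix x hx]
    · rw [planeAmp_of_ne p hx, planeAmp_of_ne p hy, interpolated_of_ne P hx,
        interpolated_of_ne P hy, mul_pow, mul_pow, hU x hx, hU y hy]
      have := hrev x y
      linear_combination α ^ 2 / (1 - p g) * this

/-- The resolvent of the absorbing discriminant solves the Poisson equation of the interpolated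
discriminant for the vector orthogonal to the stationary state in the plane of `|U⟩` and `|g⟩`. -/
theorem interpolated_resolvent {P : Matrix V V ℝ} {p f : V → ℝ} {g : V} {s α β : ℝ}
    (hU1 : ∑ x, unmarkedAmp p g x ^ 2 = 1)
    (hfix : discriminant (interpolated P g s) *ᵥ planeAmp p g α β = planeAmp p g α β)
    (hfg : f g = 0)
    (hf : ∀ x, f x - (discriminant (absorbing P g) *ᵥ f) x = unmarkedAmp p g x) (x : V) :
    β * f x - β * (discriminant (interpolated P g s) *ᵥ f) x = - planeAmp p g (-β) α x := by
  set D := discriminant (interpolated P g s)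
  set D' := discriminant (absorbing P g) with hD'
  have agree : ∀ (v : V → ℝ), v g = 0 → ∀ x, x ≠ g → (D *ᵥ v) x = (D' *ᵥ v) x := by
    intro v hv x hx
    refine Finset.sum_congr rfl fun y _ => ?_
    by_cases hy : y = g
    · rw [hy, hv, mul_zero, mul_zero]
    · exact congrArg (· * v y) (discriminant_interpolated_of_ne P hx hy s)
  by_cases hx : x = g
  · subst hx
    rw [planeAmp_self, hfg]
    -- Away from `g` the two discriminants differ only in the column of `g`; the fixed-vector
    -- equation determines that column.
    have col : ∀ y, y ≠ x → β * D y x = α * (unmarkedAmp p x y - (D' *ᵥ unmarkedAmp p x) y) := by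
      intro y hy
      have h := congrFun hfix y
      rw [planeAmp_of_ne p hy, ← agree _ (unmarkedAmp_self p x) y hy] at *
      have e : (D *ᵥ planeAmp p x α β) y = α * (D *ᵥ unmarkedAmp p x) y + β * D y x := by
        simp only [Matrix.mulVec, dotProduct, planeAmp, mul_add, Finset.sum_add_distrib,
          Finset.mul_sum, mul_ite, mul_zero, Finset.sum_ite_eq', Finset.mem_univ, if_true]
        rw [mul_comm (D y x)]
        congr 1
        exact Finset.sum_congr rfl fun z _ => by ring
      rw [e] at h
      linarith
    -- By symmetry of the absorbing discriminant, `1 - D'` moves from `U` onto `f`, leaving `α ‖U‖²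
    -- = α`.
    have h2 : β * (D *ᵥ f) x = α := by
      calc β * (D *ᵥ f) x = ∑ y, f y * (β * D y x) := by
            simp only [Matrix.mulVec, dotProduct, Finset.mul_sum]
            refine Finset.sum_congr rfl fun y _ => ?_
            rw [show D x y = D y x from discriminant_symm _ _ _]; ring
        _ = ∑ y, f y * (α * (unmarkedAmp p x y - (D' *ᵥ unmarkedAmp p x) y)) := by
            refine Finset.sum_congr rfl fun y _ => ?_
            by_cases hy : y = x
            · rw [hy, hfg, zero_mul, zero_mul]
            · rw [col y hy]
        _ = α * (∑ y, f y * unmarkedAmp p x y - ∑ y, f y * (D' *ᵥ unmarkedAmp p x) y) := by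
            rw [← Finset.sum_sub_distrib, Finset.mul_sum]
            exact Finset.sum_congr rfl fun y _ => by ring
        _ = α * ∑ y, unmarkedAmp p x y ^ 2 := by
            rw [hD', sum_mul_discriminant_mulVec, ← Finset.sum_sub_distrib]
            congr 1
            refine Finset.sum_congr rfl fun y _ => ?_
            rw [← sub_mul, hf, sq]
        _ = α := by rw [hU1, mul_one]
    rw [h2]; ring
  · rw [planeAmp_of_ne p hx, agree f hfg x hx, ← mul_sub, hf]; ring

end InterpolatedFacts

/-! ### Averages of powers of an isometry. -/

section Averages

variable {E : Type*} [NormedAddCommGroup E] [NormedSpace ℂ E]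

/-- The average of the first `N` powers of an operator. -/
def powAverage (N : ℕ) (w : E →L[ℂ] E) : E →L[ℂ] E :=
  (N : ℂ)⁻¹ • ∑ k ∈ Finset.range N, w ^ k

theorem powAverage_apply (N : ℕ) (w : E →L[ℂ] E) (x : E) :
    powAverage N w x = (N : ℂ)⁻¹ • ∑ k ∈ Finset.range N, (w ^ k) x := by
  simp [powAverage]

theorem norm_pow_apply {w : E →L[ℂ] E} (hw : ∀ x, ‖w x‖ = ‖x‖) (k : ℕ) (x : E) :
    ‖(w ^ k) x‖ = ‖x‖ := by
  induction k with
  | zero => simp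
  | succ k ih => rw [pow_succ', mul_apply_eq_comp, hw, ih]

theorem norm_powAverage_le {N : ℕ} (hN : 0 < N) {w : E →L[ℂ] E} (hw : ∀ x, ‖w x‖ = ‖x‖) (x : E) :
    ‖powAverage N w x‖ ≤ ‖x‖ := by
  have hN' : (0 : ℝ) < N := Nat.cast_pos.2 hN
  rw [powAverage_apply, norm_smul, norm_inv, Complex.norm_natCast, inv_mul_le_iff₀ hN']
  refine (norm_sum_le _ _).trans ?_
  simp only [norm_pow_apply hw]
  simp

theorem powAverage_of_fixed {N : ℕ} (hN : 0 < N) {w : E →L[ℂ] E} {x : E} (hx : w x = x) :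
    powAverage N w x = x := by
  have h : ∀ k : ℕ, (w ^ k) x = x := fun k => by
    induction k with
    | zero => simp
    | succ k ih => rw [pow_succ, mul_apply_eq_comp, hx, ih]
  have hN' : (N : ℂ) ≠ 0 := Nat.cast_ne_zero.2 hN.ne'
  rw [powAverage_apply]
  simp only [h, Finset.sum_const, Finset.card_range]
  rw [← Nat.cast_smul_eq_nsmul ℂ, inv_smul_smul₀ hN']

/-- The sum telescopes to `x - w ^ N x`. -/
theorem norm_powAverage_coboundary_le (N : ℕ) {w : E →L[ℂ] E} (hw : ∀ x, ‖w x‖ = ‖x‖) (x : E) :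
    ‖powAverage N w (x - w x)‖ ≤ 2 * ‖x‖ / N := by
  have h : ∑ k ∈ Finset.range N, (w ^ k) (x - w x) = x - (w ^ N) x := by
    have e : ∀ k : ℕ, (w ^ k) (x - w x) = (w ^ k) x - (w ^ (k + 1)) x := fun k => by
      rw [map_sub, pow_succ, mul_apply_eq_comp]
    simp only [e]
    rw [Finset.sum_range_sub']
    simp
  rw [powAverage_apply, h, norm_smul, norm_inv, Complex.norm_natCast, div_eq_inv_mul]
  refine mul_le_mul_of_nonneg_left ?_ (by positivity)
  refine (norm_sub_le _ _).trans ?_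
  rw [norm_pow_apply hw, two_mul]

/-- Contractions that approximately scale each vector of a sequence to the next. -/
theorem norm_foldl_sub_le {r : ℕ} (K : Fin r → E → E) (ψ : ℕ → E) {c δ : ℝ} (hc0 : 0 ≤ c)
    (hc1 : c ≤ 1) (hlip : ∀ i x y, ‖K i x - K i y‖ ≤ ‖x - y‖)
    (hsmul : ∀ i (a : ℝ) x, K i ((a : ℂ) • x) = (a : ℂ) • K i x)
    (hK : ∀ i : Fin r, ‖K i (ψ i) - (c : ℂ) • ψ (i + 1)‖ ≤ δ) :
    ‖(List.finRange r).foldl (fun v i => K i v) (ψ 0) - ((c ^ r : ℝ) : ℂ) • ψ r‖ ≤ r * δ := by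
  induction r with
  | zero => simp
  | succ r ih =>
    have h := ih (fun i => K i.castSucc) (fun i => hlip i.castSucc) (fun i => hsmul i.castSucc)
      (fun i => hK i.castSucc)
    rw [List.finRange_succ_last, List.foldl_append, List.foldl_map]
    simp only [List.foldl_cons, List.foldl_nil]
    set v := (List.finRange r).foldl (fun v i => K i.castSucc v) (ψ 0)
    have h2 := hK (Fin.last r)
    rw [Fin.val_last] at h2
    have h3 := hlip (Fin.last r) v (((c ^ r : ℝ) : ℂ) • ψ r)
    rw [hsmul] at h3
    have e : K (Fin.last r) v - ((c ^ (r + 1) : ℝ) : ℂ) • ψ (r + 1) =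
        (K (Fin.last r) v - ((c ^ r : ℝ) : ℂ) • K (Fin.last r) (ψ r)) +
          ((c ^ r : ℝ) : ℂ) • (K (Fin.last r) (ψ r) - (c : ℂ) • ψ (r + 1)) := by
      rw [smul_sub, smul_smul, ← Complex.ofReal_mul, ← pow_succ]; abel
    rw [e]
    refine (norm_add_le _ _).trans ?_
    -- Earlier errors pass through a contraction and the new one is scaled by `c ^ r ≤ 1`, so the
    -- errors merely add up.
    have h4 : ‖((c ^ r : ℝ) : ℂ) • (K (Fin.last r) (ψ r) - (c : ℂ) • ψ (r + 1))‖ ≤ δ := by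
      rw [norm_smul, Complex.norm_real, Real.norm_of_nonneg (pow_nonneg hc0 r)]
      exact (mul_le_of_le_one_left (norm_nonneg _) (pow_le_one₀ hc0 hc1)).trans h2
    rw [Nat.cast_succ]
    linarith

end Averages

/-! ### The walk operator and the discriminant. -/

section WalkFacts

variable {V : Type u} [Fintype V] [DecidableEq V]

/-- A matrix on the vertex registers as an operator on the Hilbert space. -/
abbrev toOp (M : Matrix (V × V) (V × V) ℂ) :
    EuclideanSpace ℂ (V × V) →L[ℂ] EuclideanSpace ℂ (V × V) :=
  Matrix.toEuclideanCLM (n := V × V) (𝕜 := ℂ) M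

theorem norm_toOp_apply {M : Matrix (V × V) (V × V) ℂ} (hM : M ∈ Matrix.unitaryGroup (V × V) ℂ)
    (x : EuclideanSpace ℂ (V × V)) : ‖toOp M x‖ = ‖x‖ :=
  ContinuousLinearMap.norm_map_of_mem_unitary
    (Unitary.map_mem (Matrix.toEuclideanCLM (n := V × V) (𝕜 := ℂ)) hM) x

theorem toOp_mul_apply (M N : Matrix (V × V) (V × V) ℂ) (x : EuclideanSpace ℂ (V × V)) :
    toOp (M * N) x = toOp M (toOp N x) := by
  rw [toOp, map_mul]; rfl

omit [Fintype V] in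
theorem swapOp_apply (G : SimpleGraph V) [DecidableRel G.Adj] (a b : V × V) :
    swapOp G a b = if G.Adj a.1 a.2 then (if b = a.swap then 1 else 0)
      else (if b = a then 1 else 0) := by
  obtain ⟨a₁, a₂⟩ := a
  obtain ⟨b₁, b₂⟩ := b
  simp only [swapOp, Matrix.of_apply, Prod.swap_prod_mk, Prod.mk.injEq]
  have := G.adj_comm b₁ b₂
  have := G.adj_comm a₁ a₂
  grind

theorem swapOp_mulVec (G : SimpleGraph V) [DecidableRel G.Adj] (v : V × V → ℂ) (a : V × V) :
    (swapOp G *ᵥ v) a = if G.Adj a.1 a.2 then v a.swap else v a := by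
  simp only [Matrix.mulVec, dotProduct, swapOp_apply]
  split_ifs <;> simp

omit [Fintype V] in
theorem swapOp_conjTranspose (G : SimpleGraph V) [DecidableRel G.Adj] :
    (swapOp G)ᴴ = swapOp G := by
  ext a b
  rw [Matrix.conjTranspose_apply, swapOp_apply, swapOp, Matrix.of_apply]
  simp only [Prod.swap]
  split_ifs <;> simp

theorem swapOp_mul_self (G : SimpleGraph V) [DecidableRel G.Adj] : swapOp G * swapOp G = 1 := by
  ext a b
  have h := swapOp_mulVec G (fun c => swapOp G c b) a
  change (swapOp G * swapOp G) a b = _ at h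
  rw [h, swapOp_apply, swapOp_apply, Matrix.one_apply]
  have := G.adj_comm a.1 a.2
  by_cases hadj : G.Adj a.1 a.2
  · simp [hadj, this.1 hadj, eq_comm]
  · simp [hadj, eq_comm]

theorem swapOp_mem_unitary (G : SimpleGraph V) [DecidableRel G.Adj] :
    swapOp G ∈ Matrix.unitaryGroup (V × V) ℂ := by
  rw [Matrix.mem_unitaryGroup_iff, Matrix.star_eq_conjTranspose, swapOp_conjTranspose,
    swapOp_mul_self]

theorem reflOp_mem_unitary (o : V) : reflOp o ∈ Matrix.unitaryGroup (V × V) ℂ := by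
  rw [Matrix.mem_unitaryGroup_iff, Matrix.star_eq_conjTranspose, reflOp,
    Matrix.diagonal_conjTranspose, Matrix.diagonal_mul_diagonal, ← Matrix.diagonal_one]
  congr 1
  ext a
  by_cases h : a.2 = o <;> simp [h]

/-- The swap conjugated by a chain unitary. -/
def conjSwap (G : SimpleGraph V) [DecidableRel G.Adj] (A : Matrix (V × V) (V × V) ℂ) :
    Matrix (V × V) (V × V) ℂ := Aᴴ * swapOp G * A

theorem conjSwap_mem_unitary (G : SimpleGraph V) [DecidableRel G.Adj]
    {A : Matrix (V × V) (V × V) ℂ} (hA : A ∈ Matrix.unitaryGroup (V × V) ℂ) :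
    conjSwap G A ∈ Matrix.unitaryGroup (V × V) ℂ :=
  mul_mem (mul_mem (Unitary.star_mem hA) (swapOp_mem_unitary G)) hA

theorem conjSwap_mul_self (G : SimpleGraph V) [DecidableRel G.Adj]
    {A : Matrix (V × V) (V × V) ℂ} (hA : A ∈ Matrix.unitaryGroup (V × V) ℂ) :
    conjSwap G A * conjSwap G A = 1 := by
  have h1 : A * Aᴴ = 1 := Matrix.mem_unitaryGroup_iff.1 hA
  have h2 : Aᴴ * A = 1 := Matrix.mem_unitaryGroup_iff'.1 hA
  calc conjSwap G A * conjSwap G A = Aᴴ * swapOp G * (A * Aᴴ) * swapOp G * A := by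
        simp only [conjSwap, Matrix.mul_assoc]
    _ = Aᴴ * (swapOp G * swapOp G) * A := by rw [h1]; simp only [Matrix.mul_assoc, Matrix.mul_one]
    _ = 1 := by rw [swapOp_mul_self, Matrix.mul_one, h2]

theorem walkOp_eq (G : SimpleGraph V) [DecidableRel G.Adj] (o : V) (A : Matrix (V × V) (V × V) ℂ) :
    walkOp G o A = conjSwap G A * reflOp o := rfl

theorem walkOp_mem_unitary (G : SimpleGraph V) [DecidableRel G.Adj] (o : V)
    {A : Matrix (V × V) (V × V) ℂ} (hA : A ∈ Matrix.unitaryGroup (V × V) ℂ) :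
    walkOp G o A ∈ Matrix.unitaryGroup (V × V) ℂ :=
  mul_mem (conjSwap_mem_unitary G hA) (reflOp_mem_unitary o)

/-- The conjugated swap compresses to the discriminant on the vectors `|x⟩|o⟩`. -/
theorem conjSwap_apply {G : SimpleGraph V} [DecidableRel G.Adj] {Q : Matrix V V ℝ}
    (h0 : ∀ x y, 0 ≤ Q x y) (hG : IsOnGraph G Q) {o : V} {A : Matrix (V × V) (V × V) ℂ}
    (hA : IsChainUnitary Q o A) (x y : V) :
    conjSwap G A (x, o) (y, o) = ((discriminant Q x y : ℝ) : ℂ) := by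
  have hsw : ∀ c, (swapOp G *ᵥ fun d => A d (y, o)) c = A c.swap (y, o) := by
    intro c
    rw [swapOp_mulVec]
    split_ifs with h
    · rfl
    · obtain ⟨c₁, c₂⟩ := c
      by_cases hc : c₁ = c₂
      · rw [hc]; rfl
      have e1 : Q c₁ c₂ = 0 := by
        by_contra h'; exact h (hG c₁ c₂ hc h')
      have e2 : Q c₂ c₁ = 0 := by
        by_contra h'; exact h (hG c₂ c₁ (Ne.symm hc) h').symm
      simp only [Prod.swap_prod_mk]
      rw [hA.2, hA.2]
      split_ifs with h1 h2 h2
      · exact absurd (h1.trans h2.symm) hc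
      · rw [← h1, e1]; simp
      · rw [← h2, e2]; simp
      · rfl
  calc conjSwap G A (x, o) (y, o)
      = ∑ c, star (A c (x, o)) * (swapOp G *ᵥ fun d => A d (y, o)) c := by
        rw [conjSwap, Matrix.mul_assoc, Matrix.mul_apply]; rfl
    _ = ∑ c : V × V, star (A c (x, o)) * A c.swap (y, o) := by simp only [hsw]
    _ = ∑ c₁, ∑ c₂, star (A (c₁, c₂) (x, o)) * A (c₂, c₁) (y, o) := by
        rw [Fintype.sum_prod_type]; rfl
    _ = ((√(Q x y) : ℝ) : ℂ) * ((√(Q y x) : ℝ) : ℂ) := by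
        simp only [hA.2]
        rw [Finset.sum_eq_single x, Finset.sum_eq_single y]
        · simp
        · intro b _ hb; simp [hb]
        · simp
        · intro b _ hb; simp [hb]
        · simp
    _ = _ := by rw [discriminant_apply, Real.sqrt_mul (h0 x y), Complex.ofReal_mul]

/-- The vector `∑ x, v x |x⟩|o⟩`. -/
def embed (o : V) (v : V → ℝ) : EuclideanSpace ℂ (V × V) :=
  WithLp.toLp 2 fun a => if a.2 = o then ((v a.1 : ℝ) : ℂ) else 0

omit [Fintype V] in
theorem embed_apply (o : V) (v : V → ℝ) (a : V × V) :
    embed o v a = if a.2 = o then ((v a.1 : ℝ) : ℂ) else 0 := rfl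

omit [Fintype V] in
theorem embed_add_smul (o : V) (c d : ℝ) (v w : V → ℝ) :
    embed o (fun x => c * v x + d * w x) = (c : ℂ) • embed o v + (d : ℂ) • embed o w := by
  ext a
  simp only [PiLp.add_apply, PiLp.smul_apply, embed_apply]
  split_ifs <;> simp

theorem inner_embed (o : V) (v : V → ℝ) (z : EuclideanSpace ℂ (V × V)) :
    inner ℂ (embed o v) z = ∑ x, (v x : ℂ) * z (x, o) := by
  rw [PiLp.inner_apply, Fintype.sum_prod_type]
  refine Finset.sum_congr rfl fun x _ => ?_
  rw [Finset.sum_eq_single o]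
  · simp [embed_apply, mul_comm]
  · intro y _ hy; simp [embed_apply, hy]
  · simp

theorem norm_sq_embed (o : V) (v : V → ℝ) : ‖embed o v‖ ^ 2 = ∑ x, v x ^ 2 := by
  have h := inner_embed o v (embed o v)
  rw [inner_self_eq_norm_sq_to_K] at h
  have h2 : ((‖embed o v‖ ^ 2 : ℝ) : ℂ) = ((∑ x, v x ^ 2 : ℝ) : ℂ) := by
    push_cast
    refine h.trans (Finset.sum_congr rfl fun x _ => ?_)
    simp [embed_apply, sq]
  exact_mod_cast h2

theorem toOp_reflOp_apply (o : V) (z : EuclideanSpace ℂ (V × V)) (a : V × V) :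
    toOp (reflOp o) z a = if a.2 = o then z a else - z a := by
  change (reflOp o *ᵥ z.ofLp) a = _
  rw [reflOp, Matrix.mulVec_diagonal]
  split_ifs <;> simp

/-! ### Lifting fixed vectors and Poisson equations to the walk. -/

section Invariant

variable {G : SimpleGraph V} [DecidableRel G.Adj] {Q : Matrix V V ℝ} {o : V}
  {A : Matrix (V × V) (V × V) ℂ}

theorem conjSwap_embed_apply (h0 : ∀ x y, 0 ≤ Q x y) (hG : IsOnGraph G Q)
    (hA : IsChainUnitary Q o A) (b : V → ℝ) (x : V) :
    toOp (conjSwap G A) (embed o b) (x, o) = (((discriminant Q *ᵥ b) x : ℝ) : ℂ) := by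
  change (conjSwap G A *ᵥ (embed o b).ofLp) (x, o) = _
  simp only [Matrix.mulVec, dotProduct, Complex.ofReal_sum, Complex.ofReal_mul,
    ← conjSwap_apply h0 hG hA]
  rw [Fintype.sum_prod_type]
  refine Finset.sum_congr rfl fun y _ => ?_
  rw [Finset.sum_eq_single o]
  · simp [embed_apply]
  · intro z _ hz; simp [embed_apply, hz]
  · simp

theorem conjSwap_conjSwap (hA : A ∈ Matrix.unitaryGroup (V × V) ℂ)
    (z : EuclideanSpace ℂ (V × V)) : toOp (conjSwap G A) (toOp (conjSwap G A) z) = z := by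
  rw [← toOp_mul_apply, conjSwap_mul_self G hA, toOp, map_one]; rfl

theorem walkOp_embed (b : V → ℝ) :
    toOp (walkOp G o A) (embed o b) = toOp (conjSwap G A) (embed o b) := by
  rw [walkOp_eq, toOp_mul_apply]
  congr 1
  ext a
  rw [toOp_reflOp_apply, embed_apply]
  split_ifs <;> simp

theorem walkOp_conjSwap_embed (h0 : ∀ x y, 0 ≤ Q x y) (hG : IsOnGraph G Q)
    (hA : IsChainUnitary Q o A) (b : V → ℝ) :
    toOp (walkOp G o A) (toOp (conjSwap G A) (embed o b)) =
      (2 : ℂ) • toOp (conjSwap G A) (embed o (discriminant Q *ᵥ b)) - embed o b := by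
  -- The reflection is `2Π - 1`, with `Π` the projection onto second register `o`; `Π` compresses
  -- the conjugated swap to the discriminant.
  have h : toOp (reflOp o) (toOp (conjSwap G A) (embed o b)) =
      (2 : ℂ) • embed o (discriminant Q *ᵥ b) - toOp (conjSwap G A) (embed o b) := by
    ext a
    rw [toOp_reflOp_apply, PiLp.sub_apply, PiLp.smul_apply, embed_apply]
    obtain ⟨x, y⟩ := a
    by_cases hy : y = o
    · subst hy
      rw [if_pos rfl, if_pos rfl, conjSwap_embed_apply h0 hG hA, smul_eq_mul]; ring
    · rw [if_neg hy, if_neg hy]; simp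
  rw [walkOp_eq, toOp_mul_apply, h, map_sub, map_smul, conjSwap_conjSwap hA.1]

theorem re_inner_embed_conjSwap (h0 : ∀ x y, 0 ≤ Q x y) (hG : IsOnGraph G Q)
    (hA : IsChainUnitary Q o A) (a b : V → ℝ) :
    RCLike.re (inner ℂ (embed o a) (toOp (conjSwap G A) (embed o b))) =
      ∑ x, a x * (discriminant Q *ᵥ b) x := by
  rw [inner_embed]
  simp only [conjSwap_embed_apply h0 hG hA]
  rw [RCLike.re_eq_complex_re, Complex.re_sum]
  exact Finset.sum_congr rfl fun x _ => by rw [← Complex.ofReal_mul, Complex.ofReal_re]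

/-- Fixed vectors of the discriminant give fixed vectors of the walk. -/
theorem walkOp_embed_of_fixed (h0 : ∀ x y, 0 ≤ Q x y) (hG : IsOnGraph G Q)
    (hA : IsChainUnitary Q o A) {v : V → ℝ} (hv : discriminant Q *ᵥ v = v) :
    toOp (walkOp G o A) (embed o v) = embed o v := by
  -- Equality case of Cauchy–Schwarz: the swap is unitary and its quadratic form at `v` is already
  -- `‖v‖²`, so it must fix `v`.
  rw [walkOp_embed, ← sub_eq_zero, ← norm_eq_zero, ← pow_eq_zero_iff two_ne_zero,
    norm_sub_sq (𝕜 := ℂ), norm_toOp_apply (conjSwap_mem_unitary G hA.1), norm_sq_embed, ← inner_conj_symm, RCLike.conj_re,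
    re_inner_embed_conjSwap h0 hG hA, hv]
  simp only [← sq]
  ring

/-- A solution of the Poisson equation of the discriminant gives one for the walk. -/
theorem exists_walkOp_coboundary (h0 : ∀ x y, 0 ≤ Q x y) (hG : IsOnGraph G Q)
    (hA : IsChainUnitary Q o A) {u b : V → ℝ}
    (hb : ∀ x, b x - (discriminant Q *ᵥ b) x = u x / 2) :
    ∃ χ, χ - toOp (walkOp G o A) χ = embed o u ∧ ‖χ‖ ^ 2 = ∑ x, u x * b x := by
  have hDb : discriminant Q *ᵥ b = fun x => 1 * b x + (-1 / 2) * u x := by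
    ext x; linarith [hb x]
  -- Write `S` for the conjugated swap. Applying `1 - W` to `(u - b) + S b` gives `u + S (2b - u -
  -- 2Db)`, and the second term vanishes by the Poisson equation.
  refine ⟨embed o (fun x => 1 * u x + (-1) * b x) + toOp (conjSwap G A) (embed o b), ?_, ?_⟩
  · rw [map_add, walkOp_embed, walkOp_conjSwap_embed h0 hG hA, hDb, embed_add_smul, embed_add_smul]
    simp only [map_add, map_smul]
    push_cast
    module
  · rw [norm_add_sq (𝕜 := ℂ), norm_toOp_apply (conjSwap_mem_unitary G hA.1), norm_sq_embed,
      norm_sq_embed, re_inner_embed_conjSwap h0 hG hA, hDb, Finset.mul_sum,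
      ← Finset.sum_add_distrib, ← Finset.sum_add_distrib]
    exact Finset.sum_congr rfl fun x _ => by ring

end Invariant

end WalkFacts

/-! ### Phase estimation on density matrices and its all-zero branch. -/

section SimulationFacts

open scoped ComplexOrder

/-- Binary expansion is a bijection; it turns a sum over ancilla strings into one over exponents. -/
theorem sum_bitVal {M : Type*} [AddCommMonoid M] (t : ℕ) (F : ℕ → M) :
    ∑ k : Fin t → Bool, F (bitVal k) = ∑ n ∈ Finset.range (2 ^ t), F n := by
  rw [← Fin.sum_univ_eq_sum_range]
  refine Fintype.sum_equiv ((Equiv.arrowCongr (Equiv.refl _) finTwoEquiv.symm).trans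
    finFunctionFinEquiv) _ _ fun k => ?_
  congr 1
  rw [Equiv.trans_apply, finFunctionFinEquiv_apply, bitVal]
  refine Finset.sum_congr rfl fun j _ => ?_
  cases h : k j <;> simp [Equiv.arrowCongr, h] <;> rfl

theorem bitVal_false (t : ℕ) : bitVal (fun _ : Fin t => false) = 0 := by simp [bitVal]

variable {V : Type u} {t : ℕ}

/-- The component of `L` with ancilla value `m`. -/
def block (L : Matrix (Idx V t) (V × V) ℂ) (m : Fin t → Bool) : Matrix (V × V) (V × V) ℂ :=
  Matrix.of fun a b => L (a, m) b

variable [Fintype V]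

/-- The partial trace over the ancilla register. -/
def ancillaTrace (ρ : Matrix (Idx V t) (Idx V t) ℂ) : Matrix (V × V) (V × V) ℂ :=
  Matrix.of fun a b => ∑ m, ρ (a, m) (b, m)

theorem ancillaTrace_conj (L : Matrix (Idx V t) (V × V) ℂ) (R : Matrix (V × V) (V × V) ℂ) :
    ancillaTrace (L * R * Lᴴ) = ∑ m, block L m * R * (block L m)ᴴ := by
  ext a b
  rw [Matrix.sum_apply]
  rfl

variable [DecidableEq V]

/-- The isometry that adjoins a fresh ancilla register. -/
def freshAncilla : Matrix (Idx V t) (V × V) ℂ :=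
  Matrix.of fun a b => if a.1 = b ∧ ∀ j, a.2 j = false then 1 else 0

theorem freshAncilla_conj (R : Matrix (V × V) (V × V) ℂ) :
    (freshAncilla : Matrix (Idx V t) (V × V) ℂ) * R *
        (freshAncilla : Matrix (Idx V t) (V × V) ℂ)ᴴ =
      Matrix.of fun a b : Idx V t => if a.2 = (fun _ => false) ∧ b.2 = (fun _ => false) then
        R a.1 b.1 else 0 := by
  ext a b
  have h : ∀ c : Idx V t, (∀ j, c.2 j = false) ↔ c.2 = fun _ => false := fun c => funext_iff.symm
  simp only [Matrix.mul_apply, freshAncilla, Matrix.of_apply, Matrix.conjTranspose_apply, h]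
  by_cases ha : a.2 = fun _ => false <;> by_cases hb : b.2 = fun _ => false <;> simp [ha, hb]

/-- When qubit `j` is still zero, a single term of the product survives and the sign of the gate
never enters. -/
theorem hadamardOp_mul_apply (j : Fin t) (L : Matrix (Idx V t) (V × V) ℂ) (a b : V × V)
    (k : Fin t → Bool) (hL : ∀ k' : Fin t → Bool, k' j = true → L (a, k') b = 0) :
    ((hadamardOp j : Matrix (Idx V t) (Idx V t) ℂ) * L) (a, k) b =
      ((1 / √2 : ℝ) : ℂ) * L (a, Function.update k j false) b := by
  rw [Matrix.mul_apply, Finset.sum_eq_single (a, Function.update k j false)]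
  · have : ∀ i, i ≠ j → k i = Function.update k j false i := fun i hi => by simp [hi]
    simp only [hadamardOp, Matrix.of_apply]
    rw [if_pos ⟨trivial, this⟩]
    simp
  · rintro ⟨a', k'⟩ _ hne
    by_cases h : a = a' ∧ ∀ i, i ≠ j → k i = k' i
    · obtain ⟨rfl, h⟩ := h
      have hk : k' j = true := by
        by_contra hk
        refine hne (Prod.ext rfl (funext fun i => ?_))
        by_cases hi : i = j
        · subst hi; simpa using hk
        · simp [hi, h i hi]
      rw [hL k' hk, mul_zero]
    · simp only [hadamardOp, Matrix.of_apply]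
      rw [if_neg h, zero_mul]
  · simp

theorem foldl_hadamardOp_apply (l : List (Fin t)) (hl : l.Nodup) (a b : V × V)
    (k : Fin t → Bool) :
    l.foldl (fun L j => (hadamardOp j : Matrix (Idx V t) (Idx V t) ℂ) * L)
        (freshAncilla : Matrix (Idx V t) (V × V) ℂ) (a, k) b =
      if a = b ∧ ∀ j, j ∉ l → k j = false then ((1 / √2 : ℝ) : ℂ) ^ l.length else 0 := by
  induction l using List.reverseRecOn generalizing a b k with
  | nil => simp [freshAncilla]
  | append_singleton l j ih =>
    rw [List.nodup_append] at hl
    have hj : j ∉ l := fun h => hl.2.2 j h j (by simp) rfl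
    rw [List.foldl_append, List.foldl_cons, List.foldl_nil, hadamardOp_mul_apply, ih hl.1]
    · have e : (∀ i, i ∉ l → Function.update k j false i = false) ↔
          ∀ i, i ∉ l ++ [j] → k i = false := by
        constructor
        · intro h i hi
          rw [List.mem_append, List.mem_singleton, not_or] at hi
          have := h i hi.1
          rwa [Function.update_of_ne hi.2] at this
        · intro h i hi
          by_cases hij : i = j
          · subst hij; simp
          · rw [Function.update_of_ne hij]
            exact h i (by simp [hi, hij])
      simp only [e, List.length_append, List.length_singleton, pow_succ']
      split_ifs <;> simp
    · intro k' hk'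
      rw [ih hl.1, if_neg]
      rintro ⟨-, h⟩
      rw [h j hj] at hk'
      exact absurd hk' (by simp)

theorem block_ctrlOp_mul (W : Matrix (V × V) (V × V) ℂ) (j : Fin t)
    (L : Matrix (Idx V t) (V × V) ℂ) (k : Fin t → Bool) :
    block (ctrlOp W j * L) k = (if k j = true then W else 1) * block L k := by
  ext a b
  simp only [block, Matrix.of_apply, Matrix.mul_apply, ctrlOp, Fintype.sum_prod_type]
  refine Finset.sum_congr rfl fun c _ => ?_
  refine Finset.sum_congr rfl fun d _ => ?_
  rw [Finset.sum_eq_single k]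
  · simp only [if_true]
    split_ifs <;> rfl
  · intro k' _ hk'
    rw [if_neg (Ne.symm hk'), zero_mul]
  · simp

theorem block_foldl_ctrlOp (W : Matrix (V × V) (V × V) ℂ) (j : Fin t) (n : ℕ)
    (L : Matrix (Idx V t) (V × V) ℂ) (k : Fin t → Bool) :
    block ((List.replicate n j).foldl (fun L j => ctrlOp W j * L) L) k =
      W ^ (if k j = true then n else 0) * block L k := by
  induction n generalizing L with
  | zero => simp
  | succ n ih =>
    rw [List.replicate_succ, List.foldl_cons, ih, block_ctrlOp_mul, ← Matrix.mul_assoc]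
    split_ifs
    · rw [pow_succ]
    · simp

theorem block_foldl_ctrlOp_pow (W : Matrix (V × V) (V × V) ℂ) (l : List (Fin t))
    (L : Matrix (Idx V t) (V × V) ℂ) (k : Fin t → Bool) :
    block (l.foldl (fun L (j : Fin t) =>
      (List.replicate (2 ^ (j : ℕ)) j).foldl (fun L j => ctrlOp W j * L) L) L) k =
      W ^ (l.map fun j => if k j = true then 2 ^ (j : ℕ) else 0).sum * block L k := by
  induction l generalizing L with
  | nil => simp
  | cons j l ih =>
    rw [List.foldl_cons, ih, block_foldl_ctrlOp, ← Matrix.mul_assoc, ← pow_add, List.map_cons,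
      List.sum_cons, add_comm]

/-- At outcome zero every phase of the transform is one. -/
theorem block_invQFTOp_mul (L : Matrix (Idx V t) (V × V) ℂ) :
    block ((invQFTOp t : Matrix (Idx V t) (Idx V t) ℂ) * L) (fun _ => false) = ((1 / √(2 ^ t) : ℝ) : ℂ) • ∑ k, block L k := by
  ext a b
  rw [Matrix.smul_apply, Matrix.sum_apply]
  simp only [block, Matrix.of_apply]
  rw [Matrix.mul_apply, Fintype.sum_prod_type, Finset.sum_eq_single a]
  · simp [invQFTOp, bitVal_false, Finset.mul_sum]
  · intro c _ hc
    simp [invQFTOp, Ne.symm hc]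
  · simp

variable {r : ℕ}

/-- The operator of a unitary instruction (the identity for the other instructions). -/
def Instr.op (W : Fin r → Matrix (V × V) (V × V) ℂ) : Instr r t → Matrix (Idx V t) (Idx V t) ℂ
  | .setup => 1
  | .check => 1
  | .reset => 1
  | .hadamard j => hadamardOp j
  | .ctrlWalk i j => ctrlOp (W i) j
  | .invQFT => invQFTOp t

/-- Tracking the one-sided factor `L` instead of the density matrix reduces the simulation to left
multiplications. -/
theorem foldl_run_of_unitary (W : Fin r → Matrix (V × V) (V × V) ℂ) (p : V → ℝ) (g o : V)
    (l : List (Instr r t))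
    (hl : ∀ ins ∈ l, ∀ σ : RunState V t, ins.run W p g o σ =
      ⟨σ.stopped, ins.op W * σ.density * (ins.op W)ᴴ⟩)
    (s : ℝ) (L : Matrix (Idx V t) (V × V) ℂ) (R : Matrix (V × V) (V × V) ℂ) :
    l.foldl (fun σ ins => ins.run W p g o σ) ⟨s, L * R * Lᴴ⟩ =
      ⟨s, l.foldl (fun L ins => ins.op W * L) L * R *
        (l.foldl (fun L ins => ins.op W * L) L)ᴴ⟩ := by
  induction l generalizing L with
  | nil => rfl
  | cons ins l ih =>
    rw [List.foldl_cons, List.foldl_cons, hl ins List.mem_cons_self]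
    have e : ins.op W * (L * R * Lᴴ) * (ins.op W)ᴴ =
        (ins.op W * L) * R * (ins.op W * L)ᴴ := by
      simp only [Matrix.conjTranspose_mul, Matrix.mul_assoc]
    simp only [e]
    exact ih (fun i hi => hl i (List.mem_cons_of_mem _ hi)) _

/-- Phase estimation conjugates by an operator whose component with outcome zero is the average
of the powers of the walk operator. -/
theorem phaseEstimation_run (W : Fin r → Matrix (V × V) (V × V) ℂ) (p : V → ℝ) (g o : V)
    (i : Fin r) (σ : RunState V t) :
    ∃ L : Matrix (Idx V t) (V × V) ℂ,
      block L (fun _ => false) =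
        ((2 ^ t : ℕ) : ℂ)⁻¹ • ∑ k ∈ Finset.range (2 ^ t), W i ^ k ∧
      (phaseEstimation t i).foldl (fun σ ins => ins.run W p g o σ) σ =
        ⟨σ.stopped, L * ancillaTrace σ.density * Lᴴ⟩ := by
  set l : List (Instr r t) := (List.finRange t).map Instr.hadamard ++
    (List.finRange t).flatMap (fun j : Fin t => List.replicate (2 ^ (j : ℕ)) (Instr.ctrlWalk i j)) ++
    [Instr.invQFT] with hl
  refine ⟨l.foldl (fun L ins => ins.op W * L) freshAncilla, ?_, ?_⟩
  · rw [hl, List.foldl_append, List.foldl_append, List.foldl_cons, List.foldl_nil, List.foldl_map,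
      List.foldl_flatMap]
    have hrep : ∀ (L : Matrix (Idx V t) (V × V) ℂ) (j : Fin t) (n : ℕ),
        (List.replicate n (Instr.ctrlWalk i j : Instr r t)).foldl (fun L ins => ins.op W * L) L =
        (List.replicate n j).foldl (fun L j => ctrlOp (W i) j * L) L := by
      intro L j n
      rw [← List.map_replicate (f := Instr.ctrlWalk i), List.foldl_map]
      rfl
    simp only [hrep]
    simp only [Instr.op]
    rw [block_invQFTOp_mul]
    simp only [block_foldl_ctrlOp_pow, ← Fin.sum_univ_def]
    have hH : ∀ k, block ((List.finRange t).foldl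
        (fun L j => (hadamardOp j : Matrix (Idx V t) (Idx V t) ℂ) * L)
        (freshAncilla : Matrix (Idx V t) (V × V) ℂ)) k = ((1 / √2 : ℝ) : ℂ) ^ t • 1 := by
      intro k
      ext a b
      rw [block, Matrix.of_apply, foldl_hadamardOp_apply _ (List.nodup_finRange t),
        Matrix.smul_apply, Matrix.one_apply]
      simp
    simp only [hH, Matrix.mul_smul, Matrix.mul_one]
    rw [← Finset.smul_sum, smul_smul, ← sum_bitVal t fun n => W i ^ n]
    congr 1
    -- The Hadamard gates and the Fourier transform each contribute `2 ^ (-t/2)`; together they form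
    -- the normalisation of the average.
    have hsq : √2 ^ t = √(2 ^ t) := by
      rw [eq_comm, Real.sqrt_eq_iff_mul_self_eq (by positivity) (by positivity), ← mul_pow,
        Real.mul_self_sqrt two_pos.le]
    rw [← Complex.ofReal_pow, ← Complex.ofReal_mul, div_pow, one_pow, hsq]
    rw [one_div_mul_one_div, Real.mul_self_sqrt (by positivity)]
    push_cast
    rw [one_div]
  · have e : phaseEstimation t i = Instr.reset :: l := by simp [phaseEstimation, hl]
    rw [e, List.foldl_cons]
    have h2 : (Instr.reset : Instr r t).run W p g o σ =
        ⟨σ.stopped, (freshAncilla : Matrix (Idx V t) (V × V) ℂ) * ancillaTrace σ.density *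
          (freshAncilla : Matrix (Idx V t) (V × V) ℂ)ᴴ⟩ := by
      rw [freshAncilla_conj]; rfl
    rw [h2]
    refine foldl_run_of_unitary W p g o l ?_ _ _ _
    intro ins hins σ
    simp only [hl, List.mem_append, List.mem_map, List.mem_flatMap, List.mem_replicate,
      List.mem_singleton] at hins
    rcases hins with (⟨j, -, rfl⟩ | ⟨j, -, -, rfl⟩) | rfl <;> rfl

/-- The state of the vertex registers dominates the (unnormalised) pure state `v`. -/
def Dominates (ρ : Matrix (Idx V t) (Idx V t) ℂ) (v : EuclideanSpace ℂ (V × V)) : Prop :=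
  (ancillaTrace ρ - Matrix.vecMulVec v.ofLp (star v.ofLp)).PosSemidef

/-- The partial trace is a sum over outcomes of positive semidefinite terms. Outcome `m` keeps the
domination, and the others are discarded. -/
theorem Dominates.conj {ρ : Matrix (Idx V t) (Idx V t) ℂ} {v : EuclideanSpace ℂ (V × V)}
    (h : Dominates ρ v) (L : Matrix (Idx V t) (V × V) ℂ) (m : Fin t → Bool) :
    Dominates (L * ancillaTrace ρ * Lᴴ) (toOp (block L m) v) := by
  have hR : (ancillaTrace ρ).PosSemidef := by
    have := h.add (Matrix.posSemidef_vecMulVec_self_star v.ofLp)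
    rwa [sub_add_cancel] at this
  have e : Matrix.vecMulVec (toOp (block L m) v).ofLp (star (toOp (block L m) v).ofLp) =
      block L m * Matrix.vecMulVec v.ofLp (star v.ofLp) * (block L m)ᴴ := by
    rw [Matrix.mul_vecMulVec, Matrix.vecMulVec_mul, Matrix.ofLp_toEuclideanCLM, Matrix.star_mulVec]
  rw [Dominates, ancillaTrace_conj, e, ← Finset.add_sum_erase _ _ (Finset.mem_univ m),
    add_sub_right_comm, ← Matrix.sub_mul, ← Matrix.mul_sub]
  exact (h.mul_mul_conjTranspose_same _).add
    (Matrix.posSemidef_sum _ fun k _ => hR.mul_mul_conjTranspose_same _)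

theorem Dominates.le_markedWeight {ρ : Matrix (Idx V t) (Idx V t) ℂ}
    {v : EuclideanSpace ℂ (V × V)} (h : Dominates ρ v) (g o : V) :
    ‖v (g, o)‖ ^ 2 ≤ markedWeight g ρ := by
  have hle : ∀ a, ‖v a‖ ^ 2 ≤ (ancillaTrace ρ a a).re := by
    intro a
    have h2 := h.diag_nonneg (i := a)
    rw [Matrix.sub_apply, Matrix.vecMulVec_apply] at h2
    have h3 := (Complex.le_def.1 h2).1
    rw [Complex.sub_re, Pi.star_apply, RCLike.star_def, Complex.mul_conj, Complex.ofReal_re,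
      Complex.normSq_eq_norm_sq, Complex.zero_re] at h3
    linarith
  have e : markedWeight g ρ = ∑ a : V × V, if a.1 = g then (ancillaTrace ρ a a).re else 0 := by
    rw [markedWeight, Fintype.sum_prod_type]
    refine Finset.sum_congr rfl fun a _ => ?_
    split_ifs
    · simp [ancillaTrace]
    · simp
  rw [e]
  refine (hle (g, o)).trans ?_
  have h0 : ∀ a : V × V, 0 ≤ if a.1 = g then (ancillaTrace ρ a a).re else 0 := by
    intro a
    split_ifs
    · exact (sq_nonneg _).trans (hle a)
    · exact le_rfl
  have := Finset.single_le_sum (fun a _ => h0 a) (Finset.mem_univ (g, o))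
  simpa using this

/-- The branch of the search loop in which all phase estimations give zero. -/
def zeroBranch (t : ℕ) (W : Fin r → Matrix (V × V) (V × V) ℂ) (v : EuclideanSpace ℂ (V × V)) :
    EuclideanSpace ℂ (V × V) :=
  (List.finRange r).foldl (fun v i => powAverage (2 ^ t) (toOp (W i)) v) v

theorem zeroBranch_smul (W : Fin r → Matrix (V × V) (V × V) ℂ) (c : ℂ)
    (v : EuclideanSpace ℂ (V × V)) : zeroBranch t W (c • v) = c • zeroBranch t W v := by
  have h : ∀ (l : List (Fin r)) (v : EuclideanSpace ℂ (V × V)),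
      l.foldl (fun v i => powAverage (2 ^ t) (toOp (W i)) v) (c • v) =
        c • l.foldl (fun v i => powAverage (2 ^ t) (toOp (W i)) v) v := by
    intro l
    induction l with
    | nil => intro v; rfl
    | cons i l ih => intro v; rw [List.foldl_cons, List.foldl_cons, map_smul, ih]
  exact h _ v

theorem searchLoop_run (W : Fin r → Matrix (V × V) (V × V) ℂ) (p : V → ℝ) (g o : V)
    (σ : RunState V t) {v : EuclideanSpace ℂ (V × V)} (h : Dominates σ.density v) :
    ((searchLoop r t).foldl (fun σ ins => ins.run W p g o σ) σ).stopped = σ.stopped ∧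
      Dominates ((searchLoop r t).foldl (fun σ ins => ins.run W p g o σ) σ).density
        (zeroBranch t W v) := by
  have key : ∀ (l : List (Fin r)) (σ : RunState V t) (v : EuclideanSpace ℂ (V × V)),
      Dominates σ.density v →
      ((l.flatMap (phaseEstimation t)).foldl (fun σ ins => ins.run W p g o σ) σ).stopped =
        σ.stopped ∧
      Dominates ((l.flatMap (phaseEstimation t)).foldl (fun σ ins => ins.run W p g o σ) σ).density
        (l.foldl (fun v i => powAverage (2 ^ t) (toOp (W i)) v) v) := by
    intro l
    induction l with
    | nil => intro σ v h; exact ⟨rfl, h⟩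
    | cons i l ih =>
      intro σ v h
      obtain ⟨L, hL, hrun⟩ := phaseEstimation_run W p g o i σ
      have h2 := h.conj L (fun _ => false)
      have e : toOp (block L fun _ => false) = powAverage (2 ^ t) (toOp (W i)) := by
        rw [hL, powAverage, toOp, map_smul, map_sum]
        simp only [map_pow]
      rw [e] at h2
      rw [List.flatMap_cons, List.foldl_append, List.foldl_cons, hrun]
      exact ih ⟨σ.stopped, _⟩ _ h2
  exact key _ σ v h

omit [Fintype V] in
theorem ancillaTrace_pureDensity (o : V) (v : V → ℝ) :
    ancillaTrace (pureDensity t o v) =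
      Matrix.vecMulVec (embed o v).ofLp (star (embed o v).ofLp) := by
  ext a b
  simp only [ancillaTrace, pureDensity, Matrix.of_apply, Matrix.vecMulVec_apply, Pi.star_apply]
  rw [Finset.sum_eq_single fun _ => false]
  · simp [embed_apply]
  · intro m _ hm; simp [hm]
  · simp

omit [Fintype V] in
theorem dominates_pureDensity (o : V) (v : V → ℝ) :
    Dominates (pureDensity t o v) (embed o v) := by
  rw [Dominates, ancillaTrace_pureDensity, sub_self]
  exact Matrix.PosSemidef.zero

theorem le_successProb_searchLoop (W : Fin r → Matrix (V × V) (V × V) ℂ) (p : V → ℝ) (g o : V)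
    (v : V → ℝ) :
    ‖zeroBranch t W (embed o v) (g, o)‖ ^ 2 ≤
      successProb W p g o (searchLoop r t) (pureDensity t o v) := by
  obtain ⟨h1, h2⟩ := searchLoop_run W p g o ⟨0, pureDensity t o v⟩ (dominates_pureDensity o v)
  have := h2.le_markedWeight g o
  simp only [successProb, h1, zero_add]
  exact this

theorem trace_pureDensity (o : V) (v : V → ℝ) :
    (pureDensity t o v).trace = ((∑ x, v x ^ 2 : ℝ) : ℂ) := by
  have h : (pureDensity t o v).trace = (ancillaTrace (pureDensity t o v)).trace := by
    simp only [Matrix.trace, Matrix.diag, ancillaTrace, Matrix.of_apply]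
    rw [Fintype.sum_prod_type]
  rw [h, ancillaTrace_pureDensity]
  simp only [Matrix.trace, Matrix.diag, Matrix.vecMulVec_apply, Pi.star_apply]
  rw [Fintype.sum_prod_type, Complex.ofReal_sum]
  refine Finset.sum_congr rfl fun x _ => ?_
  rw [Finset.sum_eq_single o]
  · simp [embed_apply, sq]
  · intro y _ hy; simp [embed_apply, hy]
  · simp

theorem markedWeight_pureDensity (g o : V) (v : V → ℝ) :
    markedWeight g (pureDensity t o v) = v g ^ 2 := by
  rw [markedWeight, Fintype.sum_prod_type, Finset.sum_eq_single (g, o),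
    Finset.sum_eq_single fun _ => false]
  · simp [pureDensity, Matrix.vecMulVec_apply, sq]
  · intro m _ hm; simp [pureDensity, Matrix.vecMulVec_apply, hm]
  · simp
  · rintro ⟨x, y⟩ _ hxy
    refine Finset.sum_eq_zero fun m _ => ?_
    by_cases hx : x = g
    · have : y ≠ o := fun hy => hxy (by rw [hx, hy])
      simp [pureDensity, Matrix.vecMulVec_apply, this]
    · simp [hx]
  · simp

omit [Fintype V] in
theorem check_pureDensity (g o : V) (v : V → ℝ) :
    (Matrix.of fun a b : Idx V t =>
      if a.1.1 = g ∨ b.1.1 = g then 0 else pureDensity t o v a b) =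
      pureDensity t o fun x => if x = g then 0 else v x := by
  ext a b
  simp only [pureDensity, Matrix.of_apply, Matrix.vecMulVec_apply, Pi.star_apply]
  by_cases ha : a.1.1 = g <;> by_cases hb : b.1.1 = g <;> simp [ha, hb]

/-- After a negative check the state is `√(1 - p g)` times the normalised unmarked state, whence the
weight `1 - p g` of the loop. -/
theorem le_successProb_searchProgram (W : Fin r → Matrix (V × V) (V × V) ℂ) {p : V → ℝ}
    (hp0 : ∀ x, 0 ≤ p x) {g : V} (hg : p g < 1) (o : V) :
    p g + (1 - p g) * ‖zeroBranch t W (embed o (unmarkedAmp p g)) (g, o)‖ ^ 2 ≤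
      successProb W p g o (searchProgram r t) (pureDensity t o (Pi.single o 1)) := by
  have hq : 0 < 1 - p g := by linarith
  set v : V → ℝ := fun x => if x = g then 0 else √(p x) with hv
  have htr : (pureDensity t o (Pi.single o (1 : ℝ))).trace = 1 := by
    rw [trace_pureDensity, Finset.sum_eq_single o]
    · simp
    · intro x _ hx; simp [hx]
    · simp
  have hstart : (([Instr.setup, Instr.check] : List (Instr r t)).foldl
      (fun σ ins => ins.run W p g o σ) ⟨0, pureDensity t o (Pi.single o 1)⟩) =
      ⟨p g, pureDensity t o v⟩ := by
    simp only [List.foldl_cons, List.foldl_nil, Instr.run, htr, one_smul, zero_add,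
      markedWeight_pureDensity, Real.sq_sqrt (hp0 g), check_pureDensity, hv]
  have hemb : embed o v = ((√(1 - p g) : ℝ) : ℂ) • embed o (unmarkedAmp p g) := by
    ext a
    have : √(1 - p g) ≠ 0 := (Real.sqrt_pos.2 hq).ne'
    have e : v a.1 = √(1 - p g) * unmarkedAmp p g a.1 := by
      simp only [hv, unmarkedAmp]
      split_ifs
      · simp
      · field_simp
    rw [PiLp.smul_apply, embed_apply, embed_apply, e]
    split_ifs <;> simp
  obtain ⟨h1, h2⟩ := searchLoop_run W p g o ⟨p g, pureDensity t o v⟩ (dominates_pureDensity o v)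
  have h3 := h2.le_markedWeight g o
  rw [hemb, zeroBranch_smul, PiLp.smul_apply, norm_smul, mul_pow, Complex.norm_real, Real.norm_eq_abs,
    sq_abs, Real.sq_sqrt hq.le] at h3
  simp only [successProb, searchProgram, List.foldl_append, hstart, h1]
  linarith

end SimulationFacts

/-! ### Angles, precision and the amplitude of the marked vertex. -/

section AmplitudeFacts

theorem angle_eq (r : ℕ) (i : Fin r) :
    angle r i = ((i : ℕ) + 1) * (Real.pi / (2 * (r + 1))) := by
  rw [angle, mul_div_assoc]

theorem step_pos (r : ℕ) : 0 < Real.pi / (2 * ((r : ℝ) + 1)) := by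
  have := Real.pi_pos; positivity

theorem step_le (r : ℕ) : Real.pi / (2 * ((r : ℝ) + 1)) ≤ Real.pi / 2 := by
  have hr : (0 : ℝ) ≤ r := Nat.cast_nonneg r
  exact div_le_div_of_nonneg_left Real.pi_pos.le two_pos (by linarith)

theorem natCast_mul_step (r : ℕ) :
    (r : ℝ) * (Real.pi / (2 * (r + 1))) = Real.pi / 2 - Real.pi / (2 * (r + 1)) := by
  have hr : (0 : ℝ) ≤ r := Nat.cast_nonneg r
  field_simp; ring

theorem angle_le (r : ℕ) (i : Fin r) : angle r i ≤ Real.pi / 2 := by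
  have h : ((i : ℕ) : ℝ) + 1 ≤ r := by exact_mod_cast i.2
  have h2 := mul_le_mul_of_nonneg_right h (step_pos r).le
  rw [natCast_mul_step, ← angle_eq] at h2
  linarith [step_pos r]

theorem step_le_angle (r : ℕ) (i : Fin r) : Real.pi / (2 * (r + 1)) ≤ angle r i := by
  rw [angle_eq]
  have : (0 : ℝ) ≤ (i : ℕ) := Nat.cast_nonneg _
  nlinarith [step_pos r]

theorem sin_step_le_sin_angle (r : ℕ) (i : Fin r) :
    Real.sin (Real.pi / (2 * (r + 1))) ≤ Real.sin (angle r i) :=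
  Real.sin_le_sin_of_le_of_le_pi_div_two (by linarith [step_pos r, Real.pi_pos]) (angle_le r i)
    (step_le_angle r i)

theorem sin_step_pos (r : ℕ) : 0 < Real.sin (Real.pi / (2 * ((r : ℝ) + 1))) :=
  Real.sin_pos_of_pos_of_lt_pi (step_pos r) (by linarith [step_le r, Real.pi_pos])

theorem cos_step_nonneg (r : ℕ) : 0 ≤ Real.cos (Real.pi / (2 * ((r : ℝ) + 1))) :=
  Real.cos_nonneg_of_mem_Icc ⟨by linarith [step_pos r, Real.pi_pos], step_le r⟩

theorem cosBound_le_one (r : ℕ) : cosBound r ≤ 1 :=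
  pow_le_one₀ (cos_step_nonneg r) (Real.cos_le_one _)

theorem cosBound_ge {r : ℕ} (hr : 11 ≤ r) : 9 / 10 ≤ cosBound r := by
  have hn : (12 : ℝ) ≤ (r : ℝ) + 1 := by
    have : (11 : ℝ) ≤ r := by exact_mod_cast hr
    linarith
  set n : ℝ := (r : ℝ) + 1 with hn'
  set y : ℝ := Real.pi ^ 2 / (8 * n ^ 2) with hy
  have hpi : Real.pi ^ 2 ≤ 9.88 := by
    have := Real.pi_lt_d4
    nlinarith [Real.pi_pos]
  have hy1 : y ≤ 1 := by
    rw [hy, div_le_one (by positivity)]; nlinarith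
  have hcos : 1 - y ≤ Real.cos (Real.pi / (2 * n)) := by
    have := Real.one_sub_sq_div_two_le_cos (x := Real.pi / (2 * n))
    have e : (Real.pi / (2 * n)) ^ 2 / 2 = y := by rw [hy]; field_simp; ring
    rwa [e] at this
  -- Bernoulli with exponent `n` would give only about `0.897` at `n = 12`. The exponent `n / 4`
  -- followed by a fourth power gives `0.9742 ^ 4 > 0.9`.
  have hB := one_add_mul_self_le_rpow_one_add (s := -y) (by linarith) (p := n / 4) (by linarith)
  have hny : n / 4 * y ≤ 9.88 / 384 := by
    have e : n / 4 * y = Real.pi ^ 2 / (32 * n) := by rw [hy]; field_simp; ring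
    rw [e, div_le_div_iff₀ (by positivity) (by norm_num)]
    nlinarith
  have h1 : (0.9742 : ℝ) ≤ (1 + -y) ^ (n / 4) := by
    refine le_trans ?_ hB; norm_num at hny ⊢; linarith
  have h2 : ((1 + -y) ^ (n / 4)) ^ 4 = (1 - y) ^ (r + 1) := by
    rw [← Real.rpow_natCast, ← Real.rpow_mul (by linarith), ← sub_eq_add_neg]
    rw [show n / 4 * ((4 : ℕ) : ℝ) = ((r + 1 : ℕ) : ℝ) by push_cast; rw [hn']; ring,
      Real.rpow_natCast]
  have h3 : (1 - y) ^ (r + 1) ≤ cosBound r := pow_le_pow_left₀ (by linarith) hcos _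
  have h4 : (0.9742 : ℝ) ^ 4 ≤ ((1 + -y) ^ (n / 4)) ^ 4 := pow_le_pow_left₀ (by norm_num) h1 4
  rw [h2] at h4
  norm_num at h4
  linarith

variable {V : Type u} [Fintype V] [DecidableEq V]

theorem precision_pos {r : ℕ} (hr : 1 ≤ r) {P : Matrix V V ℝ} {p : V → ℝ} {ε : ℝ} (hε : 0 < ε)
    (hH : 0 < hittingTime P p) : 0 < precision r P p ε := by
  have : (0 : ℝ) < r := by exact_mod_cast hr
  have := Real.pi_pos
  have := Real.sqrt_pos.2 hH
  rw [precision]; positivity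

/-- The truncation of the ceiling at zero is harmless: it only enlarges the exponent. -/
theorem precision_le_two_pow {r : ℕ} {P : Matrix V V ℝ} {p : V → ℝ} {ε : ℝ}
    (h : 0 < precision r P p ε) : precision r P p ε ≤ 2 ^ numAncilla r P p ε := by
  rw [← Real.rpow_natCast]
  calc precision r P p ε = 2 ^ Real.logb 2 (precision r P p ε) :=
        (Real.rpow_logb two_pos (by norm_num) h).symm
    _ ≤ _ := Real.rpow_le_rpow_of_exponent_le one_le_two (Nat.le_ceil _)

theorem IsErgodic.sum_eq_one {P : Matrix V V ℝ} (hP : IsErgodic P) (x : V) : ∑ y, P x y = 1 :=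
  Matrix.sum_row_of_mem_rowStochastic hP.stochastic x

/-- The last equation is the flow balance under which `cos θ_i |U⟩ + sin θ_i |g⟩` is fixed by the
interpolated discriminant. Every angle is at least the first one, so the bound on `q` at the first
angle suffices for all. -/
theorem interpParam_spec {r : ℕ} {q : ℝ} (hq0 : 0 ≤ q) (hq1 : q < 1)
    (hq : q ≤ Real.sin (Real.pi / (2 * (r + 1))) ^ 2) (i : Fin r) :
    0 ≤ interpParam r q i ∧ interpParam r q i ≤ 1 ∧
      (1 - interpParam r q i) * Real.sin (angle r i) ^ 2 * (1 - q) =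
        q * Real.cos (angle r i) ^ 2 := by
  have hs : 0 < Real.sin (angle r i) := (sin_step_pos r).trans_le (sin_step_le_sin_angle r i)
  have hs2 : 0 < Real.sin (angle r i) ^ 2 := by positivity
  have hqs : q ≤ Real.sin (angle r i) ^ 2 :=
    hq.trans (pow_le_pow_left₀ (sin_step_pos r).le (sin_step_le_sin_angle r i) 2)
  have hq' : 0 < 1 - q := by linarith
  refine ⟨div_nonneg (sub_nonneg.2 ((div_le_one hs2).2 hqs)) hq'.le, ?_, ?_⟩
  · rw [interpParam, div_le_one hq']
    have : q ≤ q / Real.sin (angle r i) ^ 2 := by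
      rw [le_div_iff₀ hs2]
      exact mul_le_of_le_one_right hq0 (Real.sin_sq_le_one _)
    linarith
  · rw [Real.cos_sq', interpParam]
    field_simp
    ring

/-- One phase estimation step rotates the plane vector by one angle, up to a small error. -/
theorem norm_powAverage_planeAmp_sub_le {P : Matrix V V ℝ} (h0 : ∀ x y, 0 ≤ P x y)
    (hirr : P.IsIrreducible) (h1 : ∀ x, ∑ y, P x y = 1) {p : V → ℝ} (hp0 : ∀ x, 0 ≤ p x)
    (hp1 : ∑ x, p x = 1) (hrev : IsReversible P p) {G : SimpleGraph V} [DecidableRel G.Adj]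
    (hG : IsOnGraph G P) {g o : V} (hg : p g < 1) {s θ δ : ℝ} (hs0 : 0 ≤ s) (hs1 : s ≤ 1)
    (hsin : 0 ≤ Real.sin θ) (hcos : 0 ≤ Real.cos θ)
    (hs : (1 - s) * Real.sin θ ^ 2 * (1 - p g) = p g * Real.cos θ ^ 2)
    {A : Matrix (V × V) (V × V) ℂ} (hA : IsChainUnitary (interpolated P g s) o A) {N : ℕ}
    (hN : 0 < N) :
    ‖powAverage N (toOp (walkOp G o A))
        (embed o (planeAmp p g (Real.cos (θ - δ)) (Real.sin (θ - δ)))) -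
      (Real.cos δ : ℂ) • embed o (planeAmp p g (Real.cos θ) (Real.sin θ))‖ ≤
      2 * √(hittingTime P p / 2) / N := by
  have hQ0 := interpolated_nonneg h0 g hs0 hs1
  have hQG := interpolated_isOnGraph hG g s
  have hfix := discriminant_interpolated_mulVec h0 h1 hp0 hrev hg hs0 hs1 hcos hsin hs
  obtain ⟨f, hfg, hf, hHT, hge⟩ := exists_resolvent hirr h1 hp0 hp1 hg
  have hres := interpolated_resolvent (sum_sq_unmarkedAmp hp0 hp1 hg) hfix hfg hf
  have hb : ∀ x, Real.sin θ / 2 * f x -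
      (discriminant (interpolated P g s) *ᵥ fun x => Real.sin θ / 2 * f x) x =
      planeAmp p g (Real.sin θ) (-Real.cos θ) x / 2 := by
    intro x
    have e : (discriminant (interpolated P g s) *ᵥ fun x => Real.sin θ / 2 * f x) x =
        Real.sin θ / 2 * (discriminant (interpolated P g s) *ᵥ f) x := by
      simp only [Matrix.mulVec, dotProduct, Finset.mul_sum]
      exact Finset.sum_congr rfl fun y _ => by ring
    have e2 : planeAmp p g (Real.sin θ) (-Real.cos θ) x =
        - planeAmp p g (-Real.sin θ) (Real.cos θ) x := by
      simp only [planeAmp]; split_ifs <;> ring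
    rw [e, e2, ← hres x]; ring
  obtain ⟨χ, hχ, hχn⟩ := exists_walkOp_coboundary hQ0 hQG hA hb
  have hχ2 : ‖χ‖ ^ 2 = Real.sin θ ^ 2 * hittingTimeTo P p g / 2 := by
    rw [hχn, ← hHT, Finset.mul_sum, Finset.sum_div]
    refine Finset.sum_congr rfl fun x _ => ?_
    by_cases hx : x = g
    · rw [hx, hfg]; ring
    · rw [planeAmp_of_ne p hx]; ring
  have hχle : ‖χ‖ ≤ √(hittingTime P p / 2) := by
    refine Real.le_sqrt_of_sq_le ?_
    rw [hχ2]
    have h2 := hittingTimeTo_le_hittingTime P p g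
    have h3 : 0 ≤ hittingTimeTo P p g := by linarith
    have h4 := mul_le_of_le_one_left h3 (Real.sin_sq_le_one θ)
    linarith
  have hiso := norm_toOp_apply (walkOp_mem_unitary G o hA.1)
  -- Decomposition along the fixed vector and the orthogonal vector, which is the coboundary.
  have hdec : embed o (planeAmp p g (Real.cos (θ - δ)) (Real.sin (θ - δ))) =
      (Real.cos δ : ℂ) • embed o (planeAmp p g (Real.cos θ) (Real.sin θ)) +
        (Real.sin δ : ℂ) • embed o (planeAmp p g (Real.sin θ) (-Real.cos θ)) := by
    rw [← embed_add_smul]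
    congr 1
    ext x
    simp only [planeAmp, Real.cos_sub, Real.sin_sub]
    split_ifs <;> ring
  rw [hdec, map_add, map_smul, map_smul,
    powAverage_of_fixed hN (walkOp_embed_of_fixed hQ0 hQG hA hfix), add_sub_cancel_left, ← hχ,
    norm_smul, Complex.norm_real, Real.norm_eq_abs]
  have hN' : (0 : ℝ) < N := Nat.cast_pos.2 hN
  calc |Real.sin δ| * ‖powAverage N (toOp (walkOp G o A)) (χ - toOp (walkOp G o A) χ)‖
      ≤ 1 * (2 * ‖χ‖ / N) := mul_le_mul (Real.abs_sin_le_one δ)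
        (norm_powAverage_coboundary_le N hiso χ) (norm_nonneg _) zero_le_one
    _ ≤ _ := by rw [one_mul]; gcongr

theorem two_mul_sqrt_div_le {r : ℕ} (hr : 1 ≤ r) {P : Matrix V V ℝ} {p : V → ℝ} {ε : ℝ}
    (hε : 0 < ε) (hH : 0 < hittingTime P p) :
    2 * √(hittingTime P p / 2) / ((2 ^ numAncilla r P p ε : ℕ) : ℝ) ≤ ε / r := by
  have hr' : (0 : ℝ) < r := by exact_mod_cast hr
  have h := precision_le_two_pow (precision_pos hr (P := P) (p := p) hε hH)
  rw [precision, div_le_iff₀ (by positivity)] at h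
  rw [div_le_div_iff₀ (by positivity) hr', Real.sqrt_div hH.le]
  push_cast
  -- Only `2 ≤ π` is needed: the precision has a factor `π / 2` to spare.
  have h2 : (r : ℝ) * 2 * √(hittingTime P p) ≤ r * Real.pi * √(hittingTime P p) := by
    have := Real.two_le_pi
    gcongr
  have h3 : 2 * (√(hittingTime P p) / √2) * r = r * 2 * √(hittingTime P p) / √2 := by ring
  rw [h3, div_le_iff₀ (by positivity)]
  linarith

/-- The amplitude of finding the marked vertex in the branch where all outcomes are zero. -/
theorem cosBound_sub_le_norm_zeroBranch {r : ℕ} (hr : 1 ≤ r) {G : SimpleGraph V}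
    [DecidableRel G.Adj] {P : Matrix V V ℝ} {p : V → ℝ} {g o : V}
    {A : Fin r → Matrix (V × V) (V × V) ℂ} {ε : ℝ} (hP : IsErgodic P) (hp : IsStationary P p)
    (hrev : IsReversible P p) (hG : IsOnGraph G P) (hg : p g < 1)
    (hq : p g ≤ Real.sin (Real.pi / (2 * (r + 1))) ^ 2)
    (hA : ∀ i, IsChainUnitary (interpolated P g (interpParam r (p g) i)) o (A i)) (hε : 0 < ε) :
    cosBound r - ε ≤ ‖zeroBranch (numAncilla r P p ε) (fun i => walkOp G o (A i))
      (embed o (unmarkedAmp p g)) (g, o)‖ := by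
  have h0 := hP.irreducible.nonneg
  have h1 := hP.sum_eq_one
  have hH : 0 < hittingTime P p := lt_of_lt_of_le (by norm_num)
    (hittingTime_ge hP.irreducible h1 hp.nonneg hp.sum_eq_one hg)
  set t := numAncilla r P p ε
  set d : ℝ := Real.pi / (2 * (r + 1)) with hd
  have hN : 0 < 2 ^ t := by positivity
  set ψ : ℕ → EuclideanSpace ℂ (V × V) := fun n =>
    embed o (planeAmp p g (Real.cos (n * d)) (Real.sin (n * d))) with hψ
  have hiso : ∀ i x, ‖toOp (walkOp G o (A i)) x‖ = ‖x‖ := fun i =>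
    norm_toOp_apply (walkOp_mem_unitary G o (hA i).1)
  have hmain := norm_foldl_sub_le
    (fun i => powAverage (2 ^ t) (toOp (walkOp G o (A i)))) ψ (c := Real.cos d) (δ := ε / r)
    (cos_step_nonneg r) (Real.cos_le_one _)
    (fun i x y => by rw [← map_sub]; exact norm_powAverage_le hN (hiso i) _)
    (fun i a x => map_smul _ _ _)
    (fun i => by
      obtain ⟨hs0, hs1, hs⟩ := interpParam_spec (hp.nonneg g) hg hq i
      have hsin : 0 ≤ Real.sin (angle r i) := (sin_step_pos r).le.trans (sin_step_le_sin_angle r i)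
      have hcos : 0 ≤ Real.cos (angle r i) := Real.cos_nonneg_of_mem_Icc
        ⟨by linarith [step_le_angle r i, step_pos r, Real.pi_pos], angle_le r i⟩
      have h := norm_powAverage_planeAmp_sub_le h0 hP.irreducible h1 hp.nonneg hp.sum_eq_one hrev hG
        hg (δ := d) hs0 hs1 hsin hcos hs (hA i) hN
      -- The index `i : Fin r` carries the angle of `ψ (i + 1)`, so this step leads from `ψ i` to `ψ
      -- (i + 1)`.
      have e1 : angle r i - d = ((i : ℕ) : ℝ) * d := by rw [angle_eq]; ring
      have e2 : angle r i = ((i + 1 : ℕ) : ℝ) * d := by rw [angle_eq]; push_cast; ring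
      rw [e1, e2] at h
      exact h.trans (two_mul_sqrt_div_le hr hε hH))
  have hr' : (r : ℝ) ≠ 0 := by positivity
  rw [mul_div_cancel₀ _ hr'] at hmain
  have hψ0 : ψ 0 = embed o (unmarkedAmp p g) := by
    simp only [hψ, Nat.cast_zero, zero_mul, Real.cos_zero, Real.sin_zero]
    congr 1
    ext x
    simp [planeAmp]
  have hψr : ψ r (g, o) = ((Real.cos d : ℝ) : ℂ) := by
    simp only [hψ, embed_apply, if_true, planeAmp_self]
    rw [hd, natCast_mul_step, Real.sin_pi_div_two_sub]
  rw [hψ0] at hmain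
  have h2 := (PiLp.norm_apply_le _ (g, o)).trans hmain
  rw [PiLp.sub_apply, PiLp.smul_apply, hψr, smul_eq_mul, ← Complex.ofReal_mul, ← pow_succ] at h2
  have h3 := norm_sub_norm_le (((Real.cos d ^ (r + 1) : ℝ) : ℂ))
    (zeroBranch t (fun i => walkOp G o (A i)) (embed o (unmarkedAmp p g)) (g, o))
  rw [norm_sub_rev, Complex.norm_real,
    Real.norm_of_nonneg (pow_nonneg (cos_step_nonneg r) _)] at h3
  have h4 := h3.trans h2
  change cosBound r - _ ≤ ε at h4
  linarith

end AmplitudeFacts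

/-! ### Exact cost of the program. -/

section CostFacts

theorem programCost_append {r t : ℕ} (S U C : ℝ) (l l' : List (Instr r t)) :
    programCost S U C (l ++ l') = programCost S U C l + programCost S U C l' := by
  simp [programCost]

theorem programCost_flatMap {r t : ℕ} (S U C : ℝ) {α : Type*} (l : List α)
    (f : α → List (Instr r t)) :
    programCost S U C (l.flatMap f) = (l.map fun a => programCost S U C (f a)).sum := by
  induction l with
  | nil => simp [programCost]
  | cons a l ih => rw [List.flatMap_cons, programCost_append, ih, List.map_cons, List.sum_cons]

theorem programCost_phaseEstimation {r : ℕ} (t : ℕ) (i : Fin r) (S U C : ℝ) :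
    programCost S U C (phaseEstimation t i) = (2 ^ t - 1) * (U + C) := by
  have h1 : programCost S U C ((List.finRange t).map (Instr.hadamard : Fin t → Instr r t)) = 0 := by
    rw [programCost, List.map_map]
    exact List.sum_eq_zero (by simp [Instr.cost])
  have h2 : ∀ j : Fin t, programCost S U C
      (List.replicate (2 ^ (j : ℕ)) (Instr.ctrlWalk i j : Instr r t)) = 2 ^ (j : ℕ) * (U + C) := by
    intro j; simp [programCost, Instr.cost]; ring
  rw [phaseEstimation, programCost_append, programCost_append, programCost_append,
    programCost_flatMap, h1]
  simp only [h2]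
  rw [← Fin.sum_univ_def, ← Finset.sum_mul, Fin.sum_univ_eq_sum_range (fun j => (2 : ℝ) ^ j),
    geom_sum_eq (by norm_num)]
  simp [programCost, Instr.cost]
  left; norm_num

theorem programCost_searchProgram (r t : ℕ) (S U C : ℝ) :
    programCost S U C (searchProgram r t) = S + C + r * ((2 ^ t - 1) * (U + C)) := by
  rw [searchProgram, programCost_append, searchLoop, programCost_flatMap]
  simp only [programCost_phaseEstimation]
  simp [programCost, Instr.cost]

end CostFacts

/-! ### Two-sided bounds for the cost and the number of ancilla qubits. -/

section ThetaBounds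

theorem sqrt_two_le_inv_mul_sqrt {ε H : ℝ} (hε : 0 < ε) (hε2 : ε ≤ 1 / 2) (hH : 1 / 2 ≤ H) :
    √2 ≤ ε⁻¹ * √H := by
  refine Real.sqrt_le_iff.2 ⟨by positivity, ?_⟩
  rw [mul_pow, Real.sq_sqrt (by linarith)]
  have h : 2 ≤ ε⁻¹ := by
    rw [le_inv_comm₀ two_pos hε]; linarith
  nlinarith

/-- The constant in the upper bounds of the cost and of the number of ancilla qubits. -/
def upperConst (r : ℕ) : ℝ := 4 + 8 * (r : ℝ) ^ 2 + 2 * Real.logb 2 (4 * r)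

variable {V : Type u} [Fintype V] [DecidableEq V] {P : Matrix V V ℝ} {p : V → ℝ} {r : ℕ} {ε : ℝ}

theorem two_mul_le_precision (hr : 1 ≤ r) (hε : 0 < ε) :
    2 * (ε⁻¹ * √(hittingTime P p)) ≤ precision r P p ε := by
  have hr' : (1 : ℝ) ≤ r := by exact_mod_cast hr
  have h2 : √2 ≤ 1.5 := Real.sqrt_le_iff.2 ⟨by norm_num, by norm_num⟩
  have h3 : 2 ≤ r * Real.pi / √2 := by
    rw [le_div_iff₀ (by positivity)]
    have := Real.pi_gt_three
    nlinarith
  have e : precision r P p ε = r * Real.pi / √2 * (ε⁻¹ * √(hittingTime P p)) := by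
    rw [precision]; field_simp
  rw [e]
  gcongr

theorem precision_le_four_mul (hε : 0 < ε) :
    precision r P p ε ≤ 4 * r * (ε⁻¹ * √(hittingTime P p)) := by
  have h3 : r * Real.pi / √2 ≤ 4 * r := by
    rw [div_le_iff₀ (by positivity)]
    have h1 : 1 ≤ √2 := Real.one_le_sqrt.2 one_le_two
    have hr : (0 : ℝ) ≤ r := Nat.cast_nonneg r
    calc r * Real.pi ≤ r * 4 := mul_le_mul_of_nonneg_left Real.pi_le_four hr
      _ = 4 * r * 1 := by ring
      _ ≤ 4 * r * √2 := by gcongr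
  have e : precision r P p ε = r * Real.pi / √2 * (ε⁻¹ * √(hittingTime P p)) := by
    rw [precision]; field_simp
  rw [e]
  gcongr

theorem two_pow_numAncilla_le (h : 1 ≤ precision r P p ε) :
    2 ^ numAncilla r P p ε ≤ 2 * precision r P p ε := by
  rw [← Real.rpow_natCast]
  calc (2 : ℝ) ^ ((numAncilla r P p ε : ℕ) : ℝ) ≤ 2 ^ (Real.logb 2 (precision r P p ε) + 1) :=
        Real.rpow_le_rpow_of_exponent_le one_le_two
          (Nat.ceil_lt_add_one (Real.logb_nonneg one_lt_two h)).le
    _ = _ := by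
        rw [Real.rpow_add two_pos, Real.rpow_logb two_pos (by norm_num) (by linarith),
          Real.rpow_one, mul_comm]

theorem cost_bounds (hr : 1 ≤ r) (hε : 0 < ε) (hε2 : ε ≤ 1 / 2) (hH : 1 / 2 ≤ hittingTime P p)
    {S U C : ℝ} (hU : 0 ≤ U) (hC : 0 ≤ C) :
    S + 1 * (ε⁻¹ * √(hittingTime P p)) * (U + C) ≤
        programCost S U C (searchProgram r (numAncilla r P p ε)) ∧
      programCost S U C (searchProgram r (numAncilla r P p ε)) ≤
        S + upperConst r * (ε⁻¹ * √(hittingTime P p)) * (U + C) := by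
  have hr' : (1 : ℝ) ≤ r := by exact_mod_cast hr
  have hx0 := sqrt_two_le_inv_mul_sqrt hε hε2 hH
  have h1 := two_mul_le_precision (P := P) (p := p) hr hε
  have h2 := precision_le_four_mul (P := P) (p := p) (r := r) hε
  set x := ε⁻¹ * √(hittingTime P p)
  have hx1 : 1 ≤ x := (Real.one_le_sqrt.2 one_le_two).trans hx0
  have h3 := precision_le_two_pow (r := r) (P := P) (p := p) (ε := ε) (by linarith)
  have h4 := two_pow_numAncilla_le (r := r) (P := P) (p := p) (ε := ε) (by linarith)
  set n : ℝ := 2 ^ numAncilla r P p ε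
  have hlog : 0 ≤ Real.logb 2 (4 * r) := Real.logb_nonneg one_lt_two (by linarith)
  rw [programCost_searchProgram]
  constructor
  -- Uses `n ≥ 2x` and `x ≥ 1`.
  · have h5 : x ≤ r * (n - 1) := by nlinarith
    have := mul_le_mul_of_nonneg_right h5 (add_nonneg hU hC)
    linarith
  -- The summand one pays for the initial check, as `C ≤ U + C`.
  · have h5 : 1 + r * (n - 1) ≤ upperConst r * x := by
      have h6 : r * (n - 1) ≤ r * (2 * (4 * r * x)) :=
        mul_le_mul_of_nonneg_left (by linarith) (by linarith)
      have h7 : 0 ≤ (3 + 2 * Real.logb 2 (4 * r)) * x := by positivity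
      rw [upperConst]
      nlinarith
    have := mul_le_mul_of_nonneg_right h5 (add_nonneg hU hC)
    linarith

theorem numAncilla_bounds (hr : 1 ≤ r) (hε : 0 < ε) (hε2 : ε ≤ 1 / 2)
    (hH : 1 / 2 ≤ hittingTime P p) :
    1 * (Real.logb 2 ε⁻¹ + Real.logb 2 √(hittingTime P p)) ≤ (numAncilla r P p ε : ℝ) ∧
      (numAncilla r P p ε : ℝ) ≤
        upperConst r * (Real.logb 2 ε⁻¹ + Real.logb 2 √(hittingTime P p)) := by
  have hr' : (1 : ℝ) ≤ r := by exact_mod_cast hr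
  have hx0 := sqrt_two_le_inv_mul_sqrt hε hε2 hH
  have h1 := two_mul_le_precision (P := P) (p := p) hr hε
  have h2 := precision_le_four_mul (P := P) (p := p) (r := r) hε
  have hs : √(hittingTime P p) ≠ 0 := (Real.sqrt_pos.2 (by linarith)).ne'
  rw [← Real.logb_mul (inv_ne_zero hε.ne') hs]
  set x := ε⁻¹ * √(hittingTime P p)
  have hx1 : 1 ≤ x := (Real.one_le_sqrt.2 one_le_two).trans hx0
  have hlog : 0 ≤ Real.logb 2 (4 * r) := Real.logb_nonneg one_lt_two (by linarith)
  have hlogx : 1 / 2 ≤ Real.logb 2 x := by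
    have h3 : (2 : ℝ) ≤ x ^ 2 := (Real.sqrt_le_left (by linarith)).1 hx0
    have h4 := Real.logb_le_logb_of_le one_lt_two two_pos h3
    rw [Real.logb_self_eq_one one_lt_two, Real.logb_pow] at h4
    push_cast at h4
    linarith
  constructor
  · rw [one_mul]
    exact (Real.logb_le_logb_of_le one_lt_two (by linarith) (by linarith)).trans (Nat.le_ceil _)
  · have h3 : (numAncilla r P p ε : ℝ) ≤ Real.logb 2 (precision r P p ε) + 1 :=
      (Nat.ceil_lt_add_one (Real.logb_nonneg one_lt_two (by linarith))).le
    have h4 := Real.logb_le_logb_of_le one_lt_two (by linarith) h2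
    rw [Real.logb_mul (by positivity) (by positivity)] at h4
    -- Since `log₂ x ≥ 1/2`, the additive constant `log₂ (4r)` is at most `2 log₂ (4r) · log₂ x`.
    have h5 : 0 ≤ Real.logb 2 (4 * r) * (Real.logb 2 x - 1 / 2) :=
      mul_nonneg hlog (by linarith)
    have h6 : 0 ≤ 8 * (r : ℝ) ^ 2 * Real.logb 2 x := by positivity
    rw [upperConst]
    nlinarith

end ThetaBounds

end QSearch
end

/-! ### Assembly of the three claims. -/

theorem theorem1 (r : ℕ) (hr : 1 ≤ r) :
    ∃ c₁ c₂ : ℝ, 0 < c₁ ∧ 0 < c₂ ∧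
      ∀ (V : Type u) [Fintype V] [DecidableEq V] (G : SimpleGraph V) [DecidableRel G.Adj]
        (P : Matrix V V ℝ) (p : V → ℝ) (g o : V)
        (A : Fin r → Matrix (V × V) (V × V) ℂ) (ε : ℝ),
        QSearch.IsErgodic P → QSearch.IsStationary P p → QSearch.IsReversible P p →
        QSearch.IsOnGraph G P →
        p g ≤ Real.sin (Real.pi / (2 * (r + 1))) ^ 2 →
        (∀ i, QSearch.IsChainUnitary
          (QSearch.interpolated P g (QSearch.interpParam r (p g) i)) o (A i)) →
        0 < ε →
        let t := QSearch.numAncilla r P p ε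
        let W : Fin r → Matrix (V × V) (V × V) ℂ := fun i => QSearch.walkOp G o (A i)
        -- success probability after the initial check has found an unmarked vertex
        let pUnmarked := QSearch.successProb W p g o (QSearch.searchLoop r t)
          (QSearch.pureDensity t o (QSearch.unmarkedAmp p g))
        -- success probability of the whole algorithm
        let pSucc := QSearch.successProb W p g o (QSearch.searchProgram r t)
          (QSearch.pureDensity t o (Pi.single o 1))
        (ε ≤ QSearch.cosBound r →
          (QSearch.cosBound r - ε) ^ 2 ≤ pUnmarked ∧ (QSearch.cosBound r - ε) ^ 2 ≤ pSucc) ∧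
        (11 ≤ r → ε ≤ 1 / 200 →
          4 / 5 < (QSearch.cosBound r - ε) ^ 2 ∧ 4 / 5 < pUnmarked ∧ 4 / 5 < pSucc) ∧
        (ε ≤ 1 / 2 →
          (∀ S U C : ℝ, 0 ≤ S → 0 ≤ U → 0 ≤ C →
            S + c₁ * (ε⁻¹ * √(QSearch.hittingTime P p)) * (U + C)
                ≤ QSearch.programCost S U C (QSearch.searchProgram r t) ∧
            QSearch.programCost S U C (QSearch.searchProgram r t)
                ≤ S + c₂ * (ε⁻¹ * √(QSearch.hittingTime P p)) * (U + C)) ∧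
          c₁ * (Real.logb 2 ε⁻¹ + Real.logb 2 √(QSearch.hittingTime P p)) ≤ (t : ℝ) ∧
          (t : ℝ) ≤ c₂ * (Real.logb 2 ε⁻¹ + Real.logb 2 √(QSearch.hittingTime P p))) := by
  have hr' : (1 : ℝ) ≤ r := by exact_mod_cast hr
  have hlog : 0 ≤ Real.logb 2 (4 * r) := Real.logb_nonneg one_lt_two (by linarith)
  refine ⟨1, QSearch.upperConst r, one_pos, by rw [QSearch.upperConst]; positivity, ?_⟩
  intro V _ _ G _ P p g o A ε hP hp hrev hG hq hA hε t W pUnmarked pSucc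
  -- For `r ≥ 1` the first angle is strictly below `π / 2`.
  have hg : p g < 1 := by
    refine hq.trans_lt ?_
    have h1 := Real.sin_sq_add_cos_sq (Real.pi / (2 * ((r : ℝ) + 1)))
    have hlt : Real.pi / (2 * ((r : ℝ) + 1)) < Real.pi / 2 :=
      div_lt_div_of_pos_left Real.pi_pos two_pos (by linarith)
    have h2 : 0 < Real.cos (Real.pi / (2 * ((r : ℝ) + 1))) :=
      Real.cos_pos_of_mem_Ioo ⟨by linarith [QSearch.step_pos r, Real.pi_pos], hlt⟩
    have := pow_pos h2 2
    linarith
  have hH := QSearch.hittingTime_ge hP.irreducible hP.sum_eq_one hp.nonneg hp.sum_eq_one hg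
  have hpart1 : ε ≤ QSearch.cosBound r →
      (QSearch.cosBound r - ε) ^ 2 ≤ pUnmarked ∧ (QSearch.cosBound r - ε) ^ 2 ≤ pSucc := by
    intro hle
    have hamp := QSearch.cosBound_sub_le_norm_zeroBranch hr hP hp hrev hG hg hq hA hε
    have hsq := pow_le_pow_left₀ (sub_nonneg.2 hle) hamp 2
    refine ⟨hsq.trans (QSearch.le_successProb_searchLoop W p g o _),
      le_trans ?_ (QSearch.le_successProb_searchProgram W hp.nonneg hg o)⟩
    -- A bound `b ≤ 1` on the loop also bounds the convex combination `p g + (1 - p g) b`.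
    have h1 : (QSearch.cosBound r - ε) ^ 2 ≤ 1 :=
      pow_le_one₀ (sub_nonneg.2 hle) (by linarith [QSearch.cosBound_le_one r])
    have h2 := mul_le_mul_of_nonneg_left hsq (sub_nonneg.2 hg.le)
    have h3 := mul_le_mul_of_nonneg_left h1 (hp.nonneg g)
    change _ ≤ p g + (1 - p g) * _
    linarith
  refine ⟨hpart1, fun hr11 hε200 => ?_, fun hε2 => ⟨fun S U C _ hU hC => ?_, ?_⟩⟩
  · have hc := QSearch.cosBound_ge hr11
    obtain ⟨h1, h2⟩ := hpart1 (by linarith)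
    -- `(9/10 - 1/200)² = 0.801025`.
    have h3 : 4 / 5 < (QSearch.cosBound r - ε) ^ 2 := by nlinarith
    exact ⟨h3, h3.trans_le h1, h3.trans_le h2⟩
  · exact QSearch.cost_bounds hr hε hε2 hH hU hC
  · exact QSearch.numAncilla_bounds hr hε hε2 hH
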